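/- **Model.** A network has $M$ sensor nodes (SNs) $\mathcal I_s$ and finitely many relay nodes (RNs) $\mathcal I_r$; let $\mathcal V=\mathcal I_s\cup\mathcal I_r$. At each time $t=0,1,2,\dots$ there is a deterministic set $\mathcal E(t)\subset\mathcal V\times\mathcal V$ of directed links, without self-loops and without links between two RNs; $(j,i)\in\mathcal E(t)$ is a link from $j$ to $i$. Let $\mathcal N_i^s(t)$ and $\mathcal N_i^r(t)$ be the sets of SNs and of RNs $j$ with $(j,i)\in\mathcal E(t)$, and $\mathcal N_i(t)=\mathcal N_i^s(t)\cup\mathcal N_i^r(t)$. Let $\chi_i(t)\in\{0,1\}$ indicate whether SN $i$ has a measurement $y_i(t)=\theta+w_i(t)$ of the unknown $\theta\in\mathbb R$ at time $t$. Let $\alpha_i(t)>0$ ($i\in\mathcal V$), $a(t)>0$ and $b_i(t)\in\mathbb R$ ($i\in\mathcal I_s$) be deterministic, let $h_{ij}(t)$ be the real random fading coefficient and $v_{ij}(t)$ the random receiver noise of the link from $j$ to $i$. Put $\boldsymbol\Delta(t)=\mathrm{diag}(\chi_1(t),\dots,\chi_M(t))$, $\mathbf L(t)=[l_{ij}(t)]_{M\times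 M}$ with, for $j\ne i$, $$l_{ij}(t)=-\alpha_j(t)\Bigl[\mathbb 1_{\{j\in\mathcal N_i^s(t)\}}h_{ij}(t)+\sum_{k\in\mathcal N_i^r(t):\,j\in\mathcal N_k^s(t)}\alpha_k(t)h_{ik}(t)h_{kj}(t)\Bigr],\qquad l_{ii}(t)=-\sum_{j\ne i}l_{ij}(t),$$ $\boldsymbol\Gamma(t)=\mathrm{diag}(\gamma_1(t),\dots,\gamma_M(t))$ with $$\gamma_i(t)=\sum_{j\in\mathcal N_i^s(t)}\alpha_j(t)h_{ij}(t)+\sum_{j\in\mathcal N_i^r(t)}\alpha_j(t)h_{ij}(t)\sum_{k\in\mathcal N_j^s(t)}\alpha_k(t)h_{jk}(t)-b_i(t),$$ $v_i(t)=\sum_{j\in\mathcal N_i(t)}v_{ij}(t)+\sum_{j\in\mathcal N_i^r(t)}\alpha_j(t)h_{ij}(t)\sum_{k\in\mathcal N_j^s(t)}v_{jk}(t)$, and $\boldsymbol\Phi=\boldsymbol\Delta+\mathbf L-\boldsymbol\Gamma$. The estimates $\mathbf x(t)\in\mathbb R^M$ of the SNs evolve by $$\mathbf x(t+1)=(\mathbf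 I-a(t)\boldsymbol\Phi(t))\mathbf x(t)+a(t)\boldsymbol\Delta(t)\mathbf y(t)+a(t)\mathbf v(t),$$ where $\mathbf y(t)=[y_i(t)]_i$, $\mathbf v(t)=[v_i(t)]_i$, and $\mathbf x(0)$ is deterministic or, more generally, square integrable and independent of all $w$, $v$ and $h$. **Assumptions.** 1. There is an integer $B>0$ such that for every $k\ge 0$ the matrix $\sum_{t=kB}^{(k+1)B-1}\mathbb E\{\mathbf A(t)\}$ is the weighted adjacency matrix of a strongly connected graph on $\mathcal V$, where $\mathbf A(t)$ has the entry $h_{ij}(t)$ at $(i,j)$ if $(j,i)\in\mathcal E(t)$ and $0$ otherwise. 2. There is an integer $T>0$ such that in every $T$ consecutive time steps at least one SN has a measurement. The noise vectors $\mathbf w(t)=[w_i(t)]_i$, $t\ge 0$, are i.i.d. with zero mean and finite variance. 3. $\mathbb E\{h_{ij}(t)\}>0$, and the second moments of the $h_{ij}(t)$ are finite and bounded in $t$; the $h_{ij}(t)$ are independent across transmitters $j$ and time steps $t$. The $v_{ij}(t)$ have zero mean and finite variances bounded in $t$, and are temporally independent. 4. The measurement noises, the receiver noises and the fading coefficients are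 mutually independent: together with 2 and 3, the groups $\{w_i(t)\}_i$, $\{v_{ij}(t)\}_{i,j}$ ($t\ge 0$) and $\{h_{ij}(t)\}_i$ ($t\ge 0$, $j\in\mathcal V$) are mutually independent. **Theorem.** Let Assumptions 1–4 hold, and let the $\alpha_i(t)$ and the $b_i(t)$ be bounded. Assume that $\mathbb E\{\boldsymbol\Gamma(t)\}=\mathbf 0$ for all $t$; that there is $0<\underline c<1$ with $\underline c\le a(t+1)/a(t)\le 1$ for large $t$, and $\lim_{t\to\infty}a(t)=0$; that for every $\nu>0$ there is $\kappa>0$ such that for all large $t$ there is an integer $T(t,\nu)>0$ with $\kappa\nu\le\sum_{s=t}^{t+T(t,\nu)}a(s)\le\nu$; and that $\sum_{t=0}^\infty a(t)^2<\infty$. Let $\tau=\max\{T,B\}$, $t_k=k\tau$, $\bar{\mathbf L}(s)=\mathbb E\{\mathbf L(s)\}$ and $$\mathbf J_k=\sum_{s=t_k}^{t_{k+1}-1}a(s)\bigl(2\boldsymbol\Delta(s)+\bar{\mathbf L}(s)+\bar{\mathbf L}(s)^T\bigr),$$ and assume that there is $c^*>0$ such that $\lambda_{\min}(\mathbf J_k)\ge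 c^*a(t_k)$ for all $k\ge 0$. Then $\mathbb E\{\|\mathbf x(t)-\theta\mathbf 1\|_2^2\}$ is finite for every $t$ and $$\lim_{t\to\infty}\mathbb E\{\|\mathbf x(t)-\theta\mathbf 1\|_2^2\}=0.$$ -/

import Mathlib

open MeasureTheory ProbabilityTheory Filter Topology

/-- Nodes of the network: `Sum.inl i` is sensor node (SN) `i`, `Sum.inr p` is relay node (RN) `p`. -/
abbrev Node (M R : ℕ) : Type := Fin M ⊕ Fin R

/-- The data of the relay-assisted estimation algorithm: a time-varying directed graph without
self-loops and without links between relay nodes (one-hop relays), deterministic weights, and the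
random noises, fading coefficients and initial estimate. -/
structure RelaySystem (M R : ℕ) (Ω : Type*) [MeasurableSpace Ω] where
  /-- `(j, i) ∈ edges t` is the communication link from node `j` to node `i` at time `t`. -/
  edges : ℕ → Set (Node M R × Node M R)
  no_self_loop : ∀ t i, (i, i) ∉ edges t
  no_relay_relay : ∀ t (p q : Fin R), (Sum.inr p, Sum.inr q) ∉ edges t
  /-- the sensor nodes that have a measurement at time `t` -/
  measuring : ℕ → Set (Fin M)
  /-- the unknown parameter -/
  θ : ℝ
  /-- amplification factors -/
  α : ℕ → Node M R → ℝ
  α_pos : ∀ t i, 0 < α t i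
  /-- innovation weights -/
  a : ℕ → ℝ
  a_pos : ∀ t, 0 < a t
  b : ℕ → Fin M → ℝ
  /-- measurement noise `w_i(t)` -/
  w : ℕ → Fin M → Ω → ℝ
  measurable_w : ∀ t i, Measurable (w t i)
  /-- receiver noise `v_ij(t)` at node `i` in the transmission from node `j` -/
  v : ℕ → Node M R → Node M R → Ω → ℝ
  measurable_v : ∀ t i j, Measurable (v t i j)
  /-- fading coefficient `h_ij(t)` of the link from node `j` to node `i` -/
  h : ℕ → Node M R → Node M R → Ω → ℝ
  measurable_h : ∀ t i j, Measurable (h t i j)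
  /-- initial estimate -/
  x₀ : Ω → Fin M → ℝ
  measurable_x₀ : Measurable x₀

/-- Entrywise expectation of a random matrix. -/
noncomputable def meanMatrix {Ω m n : Type*} [MeasurableSpace Ω] (P : Measure Ω)
    (X : Ω → Matrix m n ℝ) : Matrix m n ℝ :=
  Matrix.of fun i j => ∫ ω, X ω i j ∂P

/-- The smallest eigenvalue of a (symmetric) real matrix. -/
noncomputable def minEigenvalue {n : Type*} [Fintype n] [DecidableEq n] (A : Matrix n n ℝ) : ℝ :=
  sInf (spectrum ℝ A)

/-- The weighted digraph with an edge from `j` to `i` whenever `0 < W i j` is strongly connected. -/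
def StronglyConnected {V : Type*} (W : Matrix V V ℝ) : Prop :=
  ∀ p q : V, Relation.ReflTransGen (fun j i => 0 < W i j) p q

namespace RelaySystem

variable {M R : ℕ} {Ω : Type*} [MeasurableSpace Ω]

open Classical in
/-- The SN neighbours of node `i` at time `t`. -/
noncomputable def nbrS (S : RelaySystem M R Ω) (t : ℕ) (i : Node M R) : Finset (Fin M) :=
  Finset.univ.filter fun j => (Sum.inl j, i) ∈ S.edges t

open Classical in
/-- The RN neighbours of node `i` at time `t`. -/
noncomputable def nbrR (S : RelaySystem M R Ω) (t : ℕ) (i : Node M R) : Finset (Fin R) :=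
  Finset.univ.filter fun p => (Sum.inr p, i) ∈ S.edges t

open Classical in
/-- The adjacency matrix with fading, with entries `a_ij(t) h_ij(t)`. -/
noncomputable def adj (S : RelaySystem M R Ω) (t : ℕ) (ω : Ω) :
    Matrix (Node M R) (Node M R) ℝ :=
  Matrix.of fun i j => if (j, i) ∈ S.edges t then S.h t i j ω else 0

open Classical in
/-- `Δ(t)`, the diagonal matrix of the measurement indicators. -/
noncomputable def Δ (S : RelaySystem M R Ω) (t : ℕ) : Matrix (Fin M) (Fin M) ℝ :=
  Matrix.diagonal fun i => if i ∈ S.measuring t then 1 else 0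

/-- The off-diagonal entries `l_ij(t)`, `j ≠ i`: minus the total gain from SN `j` to SN `i`, directly
and through one relay. -/
noncomputable def lOff (S : RelaySystem M R Ω) (t : ℕ) (ω : Ω) (i j : Fin M) : ℝ :=
  -S.α t (Sum.inl j) *
    ((if j ∈ S.nbrS t (Sum.inl i) then S.h t (Sum.inl i) (Sum.inl j) ω else 0) +
      ∑ k ∈ (S.nbrR t (Sum.inl i)).filter (fun k => j ∈ S.nbrS t (Sum.inr k)),
        S.α t (Sum.inr k) * S.h t (Sum.inl i) (Sum.inr k) ω * S.h t (Sum.inr k) (Sum.inl j) ω)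

/-- The random Laplacian `L(t)`. -/
noncomputable def L (S : RelaySystem M R Ω) (t : ℕ) (ω : Ω) : Matrix (Fin M) (Fin M) ℝ :=
  Matrix.of fun i j =>
    if j = i then -∑ k ∈ Finset.univ.erase i, S.lOff t ω i k else S.lOff t ω i j

/-- The diagonal entries `γ_i(t)`. -/
noncomputable def γ (S : RelaySystem M R Ω) (t : ℕ) (ω : Ω) (i : Fin M) : ℝ :=
  ∑ j ∈ S.nbrS t (Sum.inl i), S.α t (Sum.inl j) * S.h t (Sum.inl i) (Sum.inl j) ω +
    ∑ p ∈ S.nbrR t (Sum.inl i), S.α t (Sum.inr p) * S.h t (Sum.inl i) (Sum.inr p) ω *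
      ∑ k ∈ S.nbrS t (Sum.inr p), S.α t (Sum.inl k) * S.h t (Sum.inr p) (Sum.inl k) ω
    - S.b t i

/-- The random uncertainty matrix `Γ(t)`. -/
noncomputable def Γ (S : RelaySystem M R Ω) (t : ℕ) (ω : Ω) : Matrix (Fin M) (Fin M) ℝ :=
  Matrix.diagonal (S.γ t ω)

/-- `Φ(t) = Δ(t) + L(t) - Γ(t)`. -/
noncomputable def Φ (S : RelaySystem M R Ω) (t : ℕ) (ω : Ω) : Matrix (Fin M) (Fin M) ℝ :=
  S.Δ t + S.L t ω - S.Γ t ω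

/-- The measurements `y_i(t) = θ + w_i(t)`. -/
def y (S : RelaySystem M R Ω) (t : ℕ) (ω : Ω) (i : Fin M) : ℝ :=
  S.θ + S.w t i ω

/-- The total receiver noise `v_i(t)` at SN `i`, including the noise forwarded by its relays. -/
noncomputable def vTot (S : RelaySystem M R Ω) (t : ℕ) (ω : Ω) (i : Fin M) : ℝ :=
  (∑ j ∈ S.nbrS t (Sum.inl i), S.v t (Sum.inl i) (Sum.inl j) ω +
    ∑ p ∈ S.nbrR t (Sum.inl i), S.v t (Sum.inl i) (Sum.inr p) ω) +
  ∑ p ∈ S.nbrR t (Sum.inl i), S.α t (Sum.inr p) * S.h t (Sum.inl i) (Sum.inr p) ω *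
    ∑ k ∈ S.nbrS t (Sum.inr p), S.v t (Sum.inr p) (Sum.inl k) ω

/-- The estimates `x(t)` of the sensor nodes:
`x(t+1) = (I - a(t) Φ(t)) x(t) + a(t) Δ(t) y(t) + a(t) v(t)`. -/
noncomputable def x (S : RelaySystem M R Ω) : ℕ → Ω → Fin M → ℝ
  | 0, ω => S.x₀ ω
  | t + 1, ω =>
      (1 - S.a t • S.Φ t ω).mulVec (S.x t ω) + S.a t • (S.Δ t).mulVec (S.y t ω) +
        S.a t • S.vTot t ω

/-- `L̄(t) = E{L(t)}`. -/
noncomputable def Lbar (S : RelaySystem M R Ω) (P : Measure Ω) (t : ℕ) :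
    Matrix (Fin M) (Fin M) ℝ :=
  meanMatrix P (S.L t)

/-- `J_k = ∑_{s = t_k}^{t_{k+1} - 1} a(s) (2Δ(s) + L̄(s) + L̄(s)ᵀ)`, where `t_k = k τ`. -/
noncomputable def J (S : RelaySystem M R Ω) (P : Measure Ω) (τ k : ℕ) :
    Matrix (Fin M) (Fin M) ℝ :=
  ∑ s ∈ Finset.Ico (k * τ) ((k + 1) * τ),
    S.a s • ((2 : ℝ) • S.Δ s + S.Lbar P s + (S.Lbar P s).transpose)

/-- Joint connectivity on average over the blocks `[kB, (k+1)B)`. -/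
def Assumption1 (S : RelaySystem M R Ω) (P : Measure Ω) (B : ℕ) : Prop :=
  0 < B ∧ ∀ k : ℕ,
    StronglyConnected (∑ t ∈ Finset.Ico (k * B) ((k + 1) * B), meanMatrix P (S.adj t))

/-- Some SN measures at least once in every `T` consecutive steps; the vectors `w(t)` are i.i.d.
with zero mean and finite variance. -/
structure Assumption2 (S : RelaySystem M R Ω) (P : Measure Ω) (T : ℕ) : Prop where
  T_pos : 0 < T
  measures : ∀ t, ∃ s, t ≤ s ∧ s < t + T ∧ (S.measuring s).Nonempty
  indep : iIndepFun (fun (t : ℕ) (ω : Ω) (i : Fin M) => S.w t i ω) P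
  identDistrib : ∀ t, IdentDistrib (fun ω i => S.w t i ω) (fun ω i => S.w 0 i ω) P P
  memLp : ∀ t i, MemLp (S.w t i) 2 P
  mean : ∀ t i, ∫ ω, S.w t i ω ∂P = 0

/-- The fading coefficients have positive means and finite second moments, bounded uniformly in time,
and are independent across transmitters and time steps; the receiver noises have zero mean and finite
variances, bounded uniformly in time, and are temporally independent. -/
structure Assumption3 (S : RelaySystem M R Ω) (P : Measure Ω) : Prop where
  memLp_h : ∀ t i j, MemLp (S.h t i j) 2 P
  mean_h : ∀ t i j, 0 < ∫ ω, S.h t i j ω ∂P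
  bound_h : ∃ C : ℝ, ∀ t i j, ∫ ω, S.h t i j ω ^ 2 ∂P ≤ C
  indep_h : iIndepFun
    (fun (q : ℕ × Node M R) (ω : Ω) (i : Node M R) => S.h q.1 i q.2 ω) P
  memLp_v : ∀ t i j, MemLp (S.v t i j) 2 P
  mean_v : ∀ t i j, ∫ ω, S.v t i j ω ∂P = 0
  bound_v : ∃ C : ℝ, ∀ t i j, ∫ ω, S.v t i j ω ^ 2 ∂P ≤ C
  indep_v : iIndepFun
    (fun (t : ℕ) (ω : Ω) (q : Node M R × Node M R) => S.v t q.1 q.2 ω) P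

/-- Labels of the mutually independent groups of random variables: the initial estimate, the
measurement noises at time `t`, the receiver noises at time `t`, and the fading coefficients of
transmitter `j` at time `t`. -/
inductive Source (M R : ℕ) : Type
  | init : Source M R
  | meas (t : ℕ) : Source M R
  | recv (t : ℕ) : Source M R
  | fading (t : ℕ) (j : Node M R) : Source M R

/-- The σ-algebra generated by a group of random variables. -/
@[reducible]
def sigmaOf (S : RelaySystem M R Ω) : Source M R → MeasurableSpace Ω
  | .init => MeasurableSpace.comap S.x₀ inferInstance
  | .meas t => MeasurableSpace.comap (fun ω (i : Fin M) => S.w t i ω) inferInstance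
  | .recv t =>
      MeasurableSpace.comap (fun ω (q : Node M R × Node M R) => S.v t q.1 q.2 ω) inferInstance
  | .fading t j => MeasurableSpace.comap (fun ω (i : Node M R) => S.h t i j ω) inferInstance

/-- The measurement noises, the receiver noises and the fading coefficients are mutually independent
(and independent of the initial estimate, which is vacuous if that is deterministic). -/
def Assumption4 (S : RelaySystem M R Ω) (P : Measure Ω) : Prop :=
  iIndep S.sigmaOf P

end RelaySystem

/-- `c ≤ a(t+1)/a(t) ≤ 1` for large `t`, for some `0 < c < 1`, and `a(t) → 0`. -/
def SlowDecay (a : ℕ → ℝ) : Prop :=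
  (∃ c : ℝ, 0 < c ∧ c < 1 ∧ ∀ᶠ t in atTop, c ≤ a (t + 1) / a t ∧ a (t + 1) / a t ≤ 1) ∧
    Tendsto a atTop (𝓝 0)

/-- For any `ν > 0` there is `κ > 0` such that for all large `t` there is `T > 0` with
`κ ν ≤ ∑_{s=t}^{t+T} a(s) ≤ ν`. -/
def PersistentSums (a : ℕ → ℝ) : Prop :=
  ∀ ν : ℝ, 0 < ν → ∃ κ : ℝ, 0 < κ ∧ ∀ᶠ t in atTop, ∃ T : ℕ, 0 < T ∧
    κ * ν ≤ ∑ s ∈ Finset.Icc t (t + T), a s ∧ ∑ s ∈ Finset.Icc t (t + T), a s ≤ ν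

/-! Write e = x - θ1. The rows of L sum to zero, so e(t+1) = e(t) + a(t)(n(t) - Φ(t)e(t)) with n =
Δw + v + θγ. Since E Γ = 0, n is centred and E Φ = Δ + L̄. Both Φ(t) and n(t) are functions of the
sources active at time t, hence independent of e(t), which depends on earlier sources only
(`indep_past_present`). With S(t) = E[e eᵀ], V = tr S and Q = 2Δ + L̄ + L̄ᵀ, `increment_moments`
yields V(t+1) ≤ V(t) - a(t)⟨Q(t), S(t)⟩ + O(a(t)²)(1 + V(t)).

A single Q(t) may be indefinite, because links are directed and measurements intermittent; only the
weighted sum J_k over a block is coercive. So S is frozen at the start t_k of the block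
(`tendsto_zero_of_block_coercive`): within a block S moves by O(a(t_k))(1 + V(t_k)), and this drift,
multiplied by one more step size, costs only O(a(t_k)²). The Rayleigh bound for J_k
(`minEigenvalue_J_mul_le`) then gives V(t_{k+1}) ≤ (1 - c a(t_k) + O(a(t_k)²)) V(t_k) + O(a(t_k)²).
As ∑ a(t_k) = ∞ and ∑ a(t_k)² < ∞, V(t_k) → 0 by `tendsto_zero_of_contraction`, and the drift bound
covers the times inside the blocks. -/

/-! ### Scalar recursions and step-size sums -/

/-- A perturbed contraction `u (k+1) ≤ (1 - p k) u k + q k` with `∑ p = ∞` and `∑ q < ∞` tends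
to zero. -/
theorem tendsto_zero_of_contraction {u p q : ℕ → ℝ} (hu : ∀ k, 0 ≤ u k) (hp : ∀ k, 0 ≤ p k)
    (hq : ∀ k, 0 ≤ q k) (hps : ¬ Summable p) (hqs : Summable q)
    (h : ∀ k, u (k + 1) ≤ (1 - p k) * u k + q k) : Tendsto u atTop (𝓝 0) := by
  -- Subtracting the accumulated perturbations leaves a monotone sequence bounded below, so `u`
  -- converges.
  have hanti : Antitone fun k => u k - ∑ i ∈ Finset.range k, q i := by
    refine antitone_nat_of_succ_le fun k => ?_
    rw [Finset.sum_range_succ]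
    nlinarith [h k, mul_nonneg (hp k) (hu k)]
  have hbdd : BddBelow (Set.range fun k => u k - ∑ i ∈ Finset.range k, q i) := by
    refine ⟨-∑' i, q i, ?_⟩
    rintro _ ⟨k, rfl⟩
    have := hqs.sum_le_tsum (Finset.range k) fun i _ => hq i
    have := hu k
    simp only
    linarith
  obtain ⟨l, hl⟩ : ∃ l, Tendsto u atTop (𝓝 l) := by
    have h1 := tendsto_atTop_ciInf hanti hbdd
    have h2 := h1.add hqs.hasSum.tendsto_sum_nat
    simp only [sub_add_cancel] at h2
    exact ⟨_, h2⟩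
  have hl0 : 0 ≤ l := ge_of_tendsto' hl hu
  -- Telescoping bounds ∑ p u; a positive limit of `u` would then make `p` itself summable.
  have hpu : Summable fun k => p k * u k := by
    refine summable_of_sum_range_le (c := u 0 + ∑' i, q i) (fun k => mul_nonneg (hp k) (hu k)) ?_
    intro n
    have key : u n + ∑ i ∈ Finset.range n, p i * u i ≤ u 0 + ∑ i ∈ Finset.range n, q i := by
      induction n with
      | zero => simp
      | succ n ih =>
        rw [Finset.sum_range_succ, Finset.sum_range_succ]
        nlinarith [h n]
    have := hqs.sum_le_tsum (Finset.range n) fun i _ => hq i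
    have := hu n
    linarith
  rcases hl0.eq_or_lt with h0 | h0
  · rwa [← h0] at hl
  · refine absurd ?_ hps
    have hev : ∀ᶠ k in atTop, l / 2 < u k := hl.eventually (lt_mem_nhds (by linarith))
    refine Summable.of_norm_bounded_eventually_nat (hpu.mul_left (2 / l)) ?_
    filter_upwards [hev] with k hk
    rw [Real.norm_of_nonneg (hp k)]
    have : p k * (l / 2) ≤ p k * u k := mul_le_mul_of_nonneg_left hk.le (hp k)
    calc p k = 2 / l * (p k * (l / 2)) := by field_simp
      _ ≤ _ := by gcongr

theorem sum_range_mul_le_of_antitone {f : ℕ → ℝ} (hf : Antitone f) (τ n : ℕ) :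
    ∑ i ∈ Finset.range (n * τ), f i ≤ τ * ∑ k ∈ Finset.range n, f (k * τ) := by
  induction n with
  | zero => simp
  | succ n ih =>
    rw [add_mul, one_mul, Finset.sum_range_add, Finset.sum_range_succ, mul_add]
    refine add_le_add ih ?_
    calc ∑ x ∈ Finset.range τ, f (n * τ + x) ≤ ∑ x ∈ Finset.range τ, f (n * τ) :=
          Finset.sum_le_sum fun x _ => hf (Nat.le_add_right _ _)
      _ = _ := by simp

/-- An eventually nonincreasing nonnegative sequence that is summable along the multiples of
`τ > 0` is summable. -/
theorem summable_of_summable_mul {f : ℕ → ℝ} (h0 : ∀ n, 0 ≤ f n) {N τ : ℕ} (hτ : 0 < τ)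
    (hf : ∀ n, N ≤ n → f (n + 1) ≤ f n) (hs : Summable fun k => f (k * τ)) : Summable f := by
  -- Shifting by `N * τ` rather than `N` keeps the multiples of `τ` aligned.
  have hanti : Antitone fun n => f (n + N * τ) := by
    refine antitone_nat_of_succ_le fun n => ?_
    have : N ≤ n + N * τ := (Nat.le_mul_of_pos_right N hτ).trans (Nat.le_add_left _ _)
    simpa [add_right_comm] using hf _ this
  have hs' : Summable fun k => f (k * τ + N * τ) := by
    simpa [add_mul] using (summable_nat_add_iff N).2 hs
  rw [← summable_nat_add_iff (N * τ)]
  refine summable_of_sum_range_le (c := τ * ∑' k, f (k * τ + N * τ)) (fun n => h0 _) fun n => ?_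
  calc ∑ i ∈ Finset.range n, f (i + N * τ) ≤ ∑ i ∈ Finset.range (n * τ), f (i + N * τ) :=
        Finset.sum_le_sum_of_subset_of_nonneg
          (Finset.range_mono (Nat.le_mul_of_pos_right n hτ)) fun _ _ _ => h0 _
    _ ≤ τ * ∑ k ∈ Finset.range n, f (k * τ + N * τ) := sum_range_mul_le_of_antitone hanti τ n
    _ ≤ _ := by
        gcongr
        exact hs'.sum_le_tsum _ fun _ _ => h0 _

/-- With ν = 1, windows starting arbitrarily late carry mass at least κ, so the partial sums are not
Cauchy. -/
theorem PersistentSums.not_summable {a : ℕ → ℝ} (h : PersistentSums a) : ¬ Summable a := by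
  intro hs
  obtain ⟨κ, hκ, hev⟩ := h 1 one_pos
  have hc := Metric.cauchySeq_iff.1 hs.hasSum.tendsto_sum_nat.cauchySeq κ hκ
  obtain ⟨N, hN⟩ := hc
  obtain ⟨t, ht, T, -, hT, -⟩ := ((eventually_ge_atTop N).and hev).exists
  have h1 := hN (t + T + 1) (by omega) t ht
  rw [Real.dist_eq, ← Finset.sum_Ico_eq_sub _ (by omega : t ≤ t + T + 1)] at h1
  have h2 := (abs_lt.1 h1).2
  rw [mul_one] at hT
  have h3 : Finset.Ico t (t + T + 1) = Finset.Icc t (t + T) := by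
    ext; simp
  rw [h3] at h2
  linarith

/-! ### Block Lyapunov argument -/

/-- A deterministic Lyapunov argument over blocks of length `τ` for the second moments `S i j` of a
random recursion. -/
theorem tendsto_zero_of_block_coercive {ι : Type*} [Fintype ι] {a : ℕ → ℝ} {V : ℕ → ℝ}
    {S Q : ℕ → ι → ι → ℝ} {K c : ℝ} {τ N : ℕ} (hτ : 0 < τ) (hc : 0 < c)
    (ha : ∀ t, 0 < a t) (hanti : ∀ t, N ≤ t → a (t + 1) ≤ a t) (ha0 : Tendsto a atTop (𝓝 0))
    (hns : ¬ Summable a) (hsq : Summable fun t => a t ^ 2)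
    (hV : ∀ t, V t = ∑ i, S t i i) (hV0 : ∀ t, 0 ≤ V t)
    (hQ : ∀ t i j, |Q t i j| ≤ K)
    (hS : ∀ t i j, |S (t + 1) i j - S t i j| ≤ K * a t * (1 + V t))
    (hstep : ∀ t, V (t + 1) ≤ V t - a t * (∑ i, ∑ j, Q t i j * S t i j)
      + K * a t ^ 2 * (1 + V t))
    (hJ : ∀ k, c * a (k * τ) * V (k * τ) ≤ ∑ s ∈ Finset.Ico (k * τ) ((k + 1) * τ),
      a s * (∑ i, ∑ j, Q s i j * S (k * τ) i j)) :
    Tendsto V atTop (𝓝 0) := by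
  obtain ⟨A, hA⟩ : ∃ A, ∀ t, a t ≤ A := by
    obtain ⟨A, hA⟩ := ha0.bddAbove_range
    exact ⟨A, fun t => hA ⟨t, rfl⟩⟩
  have hA0 : 0 ≤ A := (ha 0).le.trans (hA 0)
  by_cases hK : 0 ≤ K
  swap
  -- Any entry of `Q` would give 0 ≤ |Q| ≤ K, so K < 0 forces an empty index type.
  · have hz : ∀ t, V t = 0 := by
      intro t
      have : IsEmpty ι := ⟨fun i => hK ((abs_nonneg _).trans (hQ t i i))⟩
      rw [hV]; simp
    have : V = fun _ => 0 := funext hz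
    rw [this]; exact tendsto_const_nhds
  set m : ℝ := (Fintype.card ι : ℝ) with hm
  have hm0 : 0 ≤ m := Nat.cast_nonneg _
  -- `G` bounds the growth of 1 + V in one step; its power `D` below bounds it throughout a block.
  set G : ℝ := 1 + m * (K * A) with hG
  have hG1 : 1 ≤ G := by have : 0 ≤ m * (K * A) := by positivity
                         linarith
  have hVs : ∀ t s, V s - V t = ∑ i, (S s i i - S t i i) := by
    intro t s; rw [hV, hV, Finset.sum_sub_distrib]
  have hgrow1 : ∀ t, 1 + V (t + 1) ≤ G * (1 + V t) := by
    intro t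
    have h1 : V (t + 1) - V t ≤ m * (K * a t * (1 + V t)) := by
      rw [hVs]
      calc _ ≤ ∑ i : ι, K * a t * (1 + V t) :=
            Finset.sum_le_sum fun i _ => (le_abs_self _).trans (hS t i i)
        _ = _ := by simp [hm]
    have h2 : m * (K * a t * (1 + V t)) ≤ m * (K * A * (1 + V t)) := by
      have := hV0 t
      gcongr
      exact hA t
    rw [hG]; nlinarith
  set D : ℝ := G ^ τ with hD
  have hD1 : 1 ≤ D := one_le_pow₀ hG1
  have hgrow : ∀ t r, r ≤ τ → 1 + V (t + r) ≤ D * (1 + V t) := by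
    intro t r hr
    have h1 : 1 + V (t + r) ≤ G ^ r * (1 + V t) := by
      clear hr
      induction r with
      | zero => simp
      | succ r ih =>
        calc 1 + V (t + r + 1) ≤ G * (1 + V (t + r)) := hgrow1 _
          _ ≤ G * (G ^ r * (1 + V t)) := by gcongr
          _ = _ := by ring
    have := hV0 t
    refine h1.trans ?_
    gcongr
    exact pow_le_pow_right₀ hG1 hr
  have hamono : ∀ t r, N ≤ t → a (t + r) ≤ a t := by
    intro t r ht
    induction r with
    | zero => simp
    | succ r ih => exact (hanti (t + r) (by omega)).trans ih
  have hSdiff : ∀ t r i j, N ≤ t → r ≤ τ →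
      |S (t + r) i j - S t i j| ≤ τ * (K * D) * a t * (1 + V t) := by
    intro t r i j ht hr
    have hVt := hV0 t
    have hat := (ha t).le
    have h1 : |S (t + r) i j - S t i j| ≤ r * (K * D * a t * (1 + V t)) := by
      induction r with
      | zero => simp
      | succ r ih =>
        have h2 := ih (by omega)
        have h3 : |S (t + r + 1) i j - S (t + r) i j| ≤ K * D * a t * (1 + V t) := by
          refine (hS (t + r) i j).trans ?_
          calc K * a (t + r) * (1 + V (t + r)) ≤ K * a t * (D * (1 + V t)) := by
                have := hV0 (t + r)
                exact mul_le_mul (mul_le_mul_of_nonneg_left (hamono t r ht) hK)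
                  (hgrow t r (by omega)) (by linarith) (by positivity)
            _ = _ := by ring
        have h4 : S (t + (r + 1)) i j - S t i j
            = (S (t + r + 1) i j - S (t + r) i j) + (S (t + r) i j - S t i j) := by
          rw [← add_assoc]; ring
        rw [h4]
        refine (abs_add_le _ _).trans ?_
        push_cast
        linarith
    refine h1.trans ?_
    have h5 : (r : ℝ) ≤ τ := by exact_mod_cast hr
    calc (r : ℝ) * (K * D * a t * (1 + V t)) ≤ τ * (K * D * a t * (1 + V t)) := by gcongr
      _ = _ := by ring
  -- Second-order cost per step: `K * D` from the remainder in `hstep`, the rest from replacing S(t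
  -- + r) by S(t) in all m² entries, each with |Q| ≤ K and drift at most τKD a(t)(1 + V(t)).
  set E : ℝ := K * D + m * (m * (K * (τ * (K * D)))) with hE
  have hE0 : 0 ≤ E := by positivity
  have hblock : ∀ t r, N ≤ t → r ≤ τ →
      V (t + r) ≤ V t - ∑ s ∈ Finset.Ico t (t + r), a s * (∑ i, ∑ j, Q s i j * S t i j)
        + r * (E * a t ^ 2 * (1 + V t)) := by
    intro t r ht hr
    have hVt := hV0 t
    have hat := (ha t).le
    induction r with
    | zero => simp
    | succ r ih =>
      have h2 := ih (by omega)
      have h3 := hstep (t + r)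
      have h4 : K * a (t + r) ^ 2 * (1 + V (t + r)) ≤ K * D * a t ^ 2 * (1 + V t) := by
        have hVr := hV0 (t + r)
        have har := (ha (t + r)).le
        calc K * a (t + r) ^ 2 * (1 + V (t + r)) ≤ K * a t ^ 2 * (D * (1 + V t)) :=
              mul_le_mul (mul_le_mul_of_nonneg_left
                (pow_le_pow_left₀ har (hamono t r ht) 2) hK)
                (hgrow t r (by omega)) (by linarith) (by positivity)
          _ = _ := by ring
      have h5 : |(∑ i, ∑ j, Q (t + r) i j * S (t + r) i j) - ∑ i, ∑ j, Q (t + r) i j * S t i j|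
          ≤ m * (m * (K * (τ * (K * D)))) * a t * (1 + V t) := by
        rw [← Finset.sum_sub_distrib]
        refine (Finset.abs_sum_le_sum_abs _ _).trans ?_
        have : ∀ i ∈ (Finset.univ : Finset ι),
            |(∑ j, Q (t + r) i j * S (t + r) i j) - ∑ j, Q (t + r) i j * S t i j|
            ≤ m * (K * (τ * (K * D) * a t * (1 + V t))) := by
          intro i _
          rw [← Finset.sum_sub_distrib]
          refine (Finset.abs_sum_le_sum_abs _ _).trans ?_
          calc _ ≤ ∑ j : ι, K * (τ * (K * D) * a t * (1 + V t)) := by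
                refine Finset.sum_le_sum fun j _ => ?_
                rw [← mul_sub, abs_mul]
                exact mul_le_mul (hQ _ _ _) (hSdiff t r i j ht (by omega)) (abs_nonneg _) hK
            _ = _ := by simp [hm]
        refine (Finset.sum_le_sum this).trans (le_of_eq ?_)
        simp [hm]
        ring
      have h6 : a (t + r) * (∑ i, ∑ j, Q (t + r) i j * S t i j)
          - a (t + r) * (∑ i, ∑ j, Q (t + r) i j * S (t + r) i j)
          ≤ m * (m * (K * (τ * (K * D)))) * a t ^ 2 * (1 + V t) := by
        rw [← mul_sub]
        calc _ ≤ a (t + r) * (m * (m * (K * (τ * (K * D)))) * a t * (1 + V t)) := by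
              refine mul_le_mul_of_nonneg_left ?_ (ha _).le
              exact (le_abs_self _).trans (by rw [abs_sub_comm]; exact h5)
          _ ≤ a t * (m * (m * (K * (τ * (K * D)))) * a t * (1 + V t)) :=
              mul_le_mul_of_nonneg_right (hamono t r ht) (by positivity)
          _ = _ := by ring
      rw [← add_assoc, Finset.sum_Ico_succ_top (by omega)]
      have h7 : ((r + 1 : ℕ) : ℝ) * (E * a t ^ 2 * (1 + V t)) = r * (E * a t ^ 2 * (1 + V t))
          + (K * D * a t ^ 2 * (1 + V t) + m * (m * (K * (τ * (K * D)))) * a t ^ 2 * (1 + V t)) := by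
        push_cast [hE]; ring
      rw [h7]
      linarith
  have hle : ∀ k, k ≤ k * τ := fun k => Nat.le_mul_of_pos_right k hτ
  have htk : Tendsto (fun k : ℕ => k * τ) atTop atTop := tendsto_atTop_mono hle tendsto_id
  have hak : Tendsto (fun k : ℕ => a (k * τ)) atTop (𝓝 0) := ha0.comp htk
  -- From `k₀` on, the part of the block error proportional to V is absorbed by half of the coercive
  -- term.
  obtain ⟨k₀, hk₀⟩ : ∃ k₀, ∀ k, k₀ ≤ k → τ * E * a (k * τ) ≤ c / 2 := by
    have : Tendsto (fun k : ℕ => τ * E * a (k * τ)) atTop (𝓝 0) := by simpa using hak.const_mul (τ * E)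
    exact eventually_atTop.1 (this.eventually (ge_mem_nhds (by linarith)))
  set n₀ := max k₀ N with hn₀
  have hrec : Tendsto (fun k => V ((k + n₀) * τ)) atTop (𝓝 0) := by
    refine tendsto_zero_of_contraction (p := fun k => c / 2 * a ((k + n₀) * τ))
      (q := fun k => τ * E * a ((k + n₀) * τ) ^ 2) (fun k => hV0 _)
      (fun k => by have := ha ((k + n₀) * τ); positivity) (fun k => by positivity) ?_ ?_ ?_
    · intro h
      have h1 : Summable fun k => a ((k + n₀) * τ) := (summable_mul_left_iff (by positivity)).1 h
      exact hns (summable_of_summable_mul (fun n => (ha n).le) hτ hanti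
        ((summable_nat_add_iff (f := fun k => a (k * τ)) n₀).1 h1))
    · refine Summable.mul_left _ ((summable_nat_add_iff (f := fun k => a (k * τ) ^ 2) n₀).2 ?_)
      exact hsq.comp_injective (i := fun k => k * τ) fun x y hxy => Nat.eq_of_mul_eq_mul_right hτ hxy
    · intro k
      have hkN : N ≤ (k + n₀) * τ := by have := hle (k + n₀); omega
      have h1 := hblock _ τ hkN le_rfl
      have h2 := hJ (k + n₀)
      have h3 := hk₀ (k + n₀) (by omega)
      have h4 : (k + 1 + n₀) * τ = (k + n₀) * τ + τ := by ring
      have h5 : (k + n₀ + 1) * τ = (k + n₀) * τ + τ := by ring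
      rw [h5] at h2
      rw [h4]
      have h6 : τ * E * a ((k + n₀) * τ) * (a ((k + n₀) * τ) * V ((k + n₀) * τ)) ≤
          c / 2 * (a ((k + n₀) * τ) * V ((k + n₀) * τ)) :=
        mul_le_mul_of_nonneg_right h3 (mul_nonneg (ha _).le (hV0 _))
      nlinarith
  have hrec' : Tendsto (fun k => V (k * τ)) atTop (𝓝 0) :=
    (tendsto_add_atTop_iff_nat (f := fun k => V (k * τ)) n₀).1 hrec
  have hbd : Tendsto (fun k => V (k * τ) + m * (τ * (K * D) * a (k * τ) * (1 + V (k * τ))))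
      atTop (𝓝 0) := by
    have := hrec'.add (((hak.const_mul (τ * (K * D))).mul (hrec'.const_add 1)).const_mul m)
    simpa using this
  have hdiv : Tendsto (fun t : ℕ => t / τ) atTop atTop :=
    Nat.tendsto_div_const_atTop hτ.ne'
  refine squeeze_zero' (Eventually.of_forall hV0) ?_ (hbd.comp hdiv)
  filter_upwards [hdiv.eventually_ge_atTop N] with t ht
  have hN : N ≤ t / τ * τ := ht.trans (hle _)
  -- A general time is compared with the start of its block through the drift bound.
  have h1 : V t - V (t / τ * τ) ≤ m * (τ * (K * D) * a (t / τ * τ) * (1 + V (t / τ * τ))) := by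
    rw [hVs]
    calc _ ≤ ∑ i : ι, (τ * (K * D) * a (t / τ * τ) * (1 + V (t / τ * τ))) := by
          refine Finset.sum_le_sum fun i _ => (le_abs_self _).trans ?_
          have := hSdiff (t / τ * τ) (t % τ) i i hN (Nat.mod_lt _ hτ).le
          rwa [Nat.div_add_mod'] at this
      _ = _ := by simp [hm]
  simp only [Function.comp]
  linarith

/-! ### Rayleigh bound -/

/-- Subtracting λ_min I shifts the spectrum into [0, ∞), so the difference is positive semidefinite.
-/
theorem minEigenvalue_mul_dotProduct_le {n : Type*} [Fintype n] [DecidableEq n]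
    {A : Matrix n n ℝ} (hA : A.IsHermitian) (x : n → ℝ) :
    minEigenvalue A * ∑ i, x i ^ 2 ≤ ∑ i, ∑ j, A i j * (x i * x j) := by
  have hpos : (A - algebraMap ℝ (Matrix n n ℝ) (minEigenvalue A)).PosSemidef := by
    rw [Matrix.posSemidef_iff_isHermitian_and_spectrum_nonneg]
    refine ⟨hA.sub ?_, fun μ hμ => ?_⟩
    · rw [Matrix.algebraMap_eq_diagonal]
      exact Matrix.isHermitian_diagonal _
    · rw [← spectrum.sub_singleton_eq] at hμ
      obtain ⟨ν, hν, r, hr, rfl⟩ := hμ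
      rw [Set.mem_singleton_iff] at hr
      have : minEigenvalue A ≤ ν := csInf_le (Matrix.finite_spectrum A).bddBelow hν
      simp only [hr, Set.mem_ofPred_eq]
      linarith
  have h := (Matrix.posSemidef_iff_dotProduct_mulVec.1 hpos).2 x
  rw [Matrix.sub_mulVec, dotProduct_sub, Matrix.algebraMap_eq_diagonal] at h
  have h0 : (Matrix.diagonal (algebraMap ℝ (n → ℝ) (minEigenvalue A))).mulVec x
      = fun i => minEigenvalue A * x i := by
    ext i; simp [Matrix.mulVec_diagonal]
  rw [h0] at h
  simp only [dotProduct, Matrix.mulVec, star_trivial] at h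
  have h1 : ∑ i, ∑ j, A i j * (x i * x j) = ∑ i, x i * ∑ j, A i j * x j := by
    refine Finset.sum_congr rfl fun i _ => ?_
    rw [Finset.mul_sum]
    exact Finset.sum_congr rfl fun j _ => by ring
  have h2 : minEigenvalue A * ∑ i, x i ^ 2 = ∑ i, x i * (minEigenvalue A * x i) := by
    rw [Finset.mul_sum]
    exact Finset.sum_congr rfl fun j _ => by ring
  rw [h1, h2]
  linarith

/-! ### Second moments and independence -/

section Moments

variable {Ω : Type*} [mΩ : MeasurableSpace Ω] {P : Measure Ω}

theorem indepFun_of_indep {m₁ m₂ : MeasurableSpace Ω} (h : Indep m₁ m₂ P) {X Y : Ω → ℝ}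
    (hX : Measurable[m₁] X) (hY : Measurable[m₂] Y) : IndepFun X Y P :=
  (IndepFun_iff_Indep X Y P).2 (indep_of_indep_of_le h hX.comap_le hY.comap_le)

/-- Independence passes to the squares. Without it a product of two L² variables is only known to be
in L¹; this keeps two-hop gains and the products Φ e in L². -/
theorem integral_sq_mul_of_indepFun {X Y : Ω → ℝ} (hX : MemLp X 2 P) (hY : MemLp Y 2 P)
    (h : IndepFun X Y P) : MemLp (fun ω => X ω * Y ω) 2 P ∧
      ∫ ω, (X ω * Y ω) ^ 2 ∂P = (∫ ω, X ω ^ 2 ∂P) * ∫ ω, Y ω ^ 2 ∂P := by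
  have h2 : IndepFun (fun ω => X ω ^ 2) (fun ω => Y ω ^ 2) P :=
    h.comp (φ := fun x : ℝ => x ^ 2) (ψ := fun x : ℝ => x ^ 2) (by fun_prop) (by fun_prop)
  constructor
  · refine (memLp_two_iff_integrable_sq (hX.1.mul hY.1)).2 ?_
    simp only [Pi.mul_apply, mul_pow]
    exact h2.integrable_mul hX.integrable_sq hY.integrable_sq
  · simp only [mul_pow]
    exact h2.integral_fun_mul_eq_mul_integral (hX.1.pow 2) (hY.1.pow 2)

/-- The arithmetic-geometric form of Cauchy–Schwarz keeps all estimates linear in the second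
moments, with no square roots. -/
theorem abs_integral_mul_le {X Y : Ω → ℝ} (hX : MemLp X 2 P) (hY : MemLp Y 2 P) :
    |∫ ω, X ω * Y ω ∂P| ≤ ((∫ ω, X ω ^ 2 ∂P) + ∫ ω, Y ω ^ 2 ∂P) / 2 := by
  rw [← integral_add hX.integrable_sq hY.integrable_sq, ← integral_div]
  refine abs_integral_le_integral_abs.trans (integral_mono (hX.integrable_mul hY).abs
    ((hX.integrable_sq.add hY.integrable_sq).div_const 2) fun ω => ?_)
  simp only [abs_mul]
  nlinarith [sq_nonneg (|X ω| - |Y ω|), sq_abs (X ω), sq_abs (Y ω)]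

theorem abs_integral_le_of_memLp [IsProbabilityMeasure P] {X : Ω → ℝ} (hX : MemLp X 2 P) :
    |∫ ω, X ω ∂P| ≤ ((∫ ω, X ω ^ 2 ∂P) + 1) / 2 := by
  simpa using abs_integral_mul_le hX (memLp_const (1 : ℝ))

/-- A sequence of square integrable random variables with bounded second moments. -/
def L2Bdd (P : Measure Ω) (X : ℕ → Ω → ℝ) : Prop :=
  (∀ t, MemLp (X t) 2 P) ∧ ∃ C, ∀ t, ∫ ω, X t ω ^ 2 ∂P ≤ C

namespace L2Bdd

variable {X Y : ℕ → Ω → ℝ}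

theorem add (hX : L2Bdd P X) (hY : L2Bdd P Y) : L2Bdd P fun t ω => X t ω + Y t ω := by
  obtain ⟨hX, C, hC⟩ := hX
  obtain ⟨hY, D, hD⟩ := hY
  refine ⟨fun t => (hX t).add (hY t), 2 * (C + D), fun t => ?_⟩
  calc ∫ ω, (X t ω + Y t ω) ^ 2 ∂P ≤ ∫ ω, 2 * (X t ω ^ 2 + Y t ω ^ 2) ∂P :=
        integral_mono ((hX t).add (hY t)).integrable_sq
          (((hX t).integrable_sq.add (hY t).integrable_sq).const_mul 2) fun ω => add_sq_le
    _ = 2 * ((∫ ω, X t ω ^ 2 ∂P) + ∫ ω, Y t ω ^ 2 ∂P) := by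
        rw [integral_const_mul, integral_add (hX t).integrable_sq (hY t).integrable_sq]
    _ ≤ _ := by gcongr; exacts [hC t, hD t]

theorem const_mul (hX : L2Bdd P X) {c : ℕ → ℝ} {C : ℝ} (hc : ∀ t, |c t| ≤ C) :
    L2Bdd P fun t ω => c t * X t ω := by
  obtain ⟨hX, D, hD⟩ := hX
  refine ⟨fun t => (hX t).const_mul _, C ^ 2 * D, fun t => ?_⟩
  simp only [mul_pow]
  rw [integral_const_mul]
  have h1 : c t ^ 2 ≤ C ^ 2 := by
    rw [← sq_abs]; exact pow_le_pow_left₀ (abs_nonneg _) (hc t) 2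
  exact mul_le_mul h1 (hD t) (integral_nonneg fun ω => sq_nonneg _) (sq_nonneg _)

theorem neg (hX : L2Bdd P X) : L2Bdd P fun t ω => -X t ω := by
  simpa using hX.const_mul (c := fun _ => -1) (C := 1) (by simp)

theorem zero : L2Bdd P fun _ _ => 0 := ⟨fun _ => MemLp.zero', 0, by simp⟩

theorem const [IsProbabilityMeasure P] {c : ℕ → ℝ} {C : ℝ} (hc : ∀ t, |c t| ≤ C) :
    L2Bdd P fun t _ => c t := by
  have h1 : L2Bdd P fun _ _ => 1 := ⟨fun _ => memLp_const _, 1, by simp⟩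
  simpa using h1.const_mul hc

theorem sum {ι : Type*} (s : Finset ι) {X : ι → ℕ → Ω → ℝ} (hX : ∀ i ∈ s, L2Bdd P (X i)) :
    L2Bdd P fun t ω => ∑ i ∈ s, X i t ω := by
  classical
  induction s using Finset.induction_on with
  | empty => simpa only [Finset.sum_empty] using zero
  | insert i s hi ih =>
    simp only [Finset.sum_insert hi]
    exact (hX i (by simp)).add (ih fun j hj => hX j (by simp [hj]))

theorem ite (hX : L2Bdd P X) (p : ℕ → Prop) [∀ t, Decidable (p t)] :
    L2Bdd P fun t ω => if p t then X t ω else 0 := by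
  have := hX.const_mul (c := fun t => if p t then 1 else 0) (C := 1)
    (fun t => by split_ifs <;> simp)
  simpa using this

/-- Summation over index sets that vary in time. -/
theorem sum_varying {ι : Type*} [Fintype ι] (s : ℕ → Finset ι) {X : ι → ℕ → Ω → ℝ}
    (hX : ∀ i, L2Bdd P (X i)) : L2Bdd P fun t ω => ∑ i ∈ s t, X i t ω := by
  classical
  -- The moving index set becomes a fixed sum with 0/1 coefficients, so the bound is uniform in
  -- time.
  have := sum Finset.univ fun i _ => (hX i).ite fun t => i ∈ s t
  refine (congrArg (L2Bdd P) ?_).mp this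
  funext t ω
  rw [← Finset.sum_filter]
  congr 1
  ext; simp

theorem mul_of_indepFun (hX : L2Bdd P X) (hY : L2Bdd P Y) (h : ∀ t, IndepFun (X t) (Y t) P) :
    L2Bdd P fun t ω => X t ω * Y t ω := by
  obtain ⟨hX, C, hC⟩ := hX
  obtain ⟨hY, D, hD⟩ := hY
  refine ⟨fun t => (integral_sq_mul_of_indepFun (hX t) (hY t) (h t)).1, C * D, fun t => ?_⟩
  rw [(integral_sq_mul_of_indepFun (hX t) (hY t) (h t)).2]
  have h0 : 0 ≤ ∫ ω, X t ω ^ 2 ∂P := integral_nonneg fun ω => sq_nonneg _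
  exact mul_le_mul (hC t) (hD t) (integral_nonneg fun ω => sq_nonneg _) (h0.trans (hC t))

theorem exists_bound {ι : Type*} [Finite ι] {X : ι → ℕ → Ω → ℝ} (hX : ∀ i, L2Bdd P (X i)) :
    ∃ C, 0 ≤ C ∧ ∀ i t, ∫ ω, X i t ω ^ 2 ∂P ≤ C := by
  choose C hC using fun i => (hX i).2
  obtain ⟨D, hD⟩ := (Set.finite_range C).bddAbove
  exact ⟨max D 0, le_max_right _ _, fun i t =>
    (hC i t).trans ((hD ⟨i, rfl⟩).trans (le_max_left _ _))⟩

end L2Bdd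

/-- An integrable random variable with zero mean. -/
def Centered (P : Measure Ω) (X : Ω → ℝ) : Prop :=
  Integrable X P ∧ ∫ ω, X ω ∂P = 0

namespace Centered

variable {X Y : Ω → ℝ}

theorem add (hX : Centered P X) (hY : Centered P Y) : Centered P fun ω => X ω + Y ω :=
  ⟨hX.1.add hY.1, by rw [integral_add hX.1 hY.1, hX.2, hY.2, add_zero]⟩

theorem const_mul (hX : Centered P X) (c : ℝ) : Centered P fun ω => c * X ω :=
  ⟨hX.1.const_mul c, by rw [integral_const_mul, hX.2, mul_zero]⟩

theorem sum {ι : Type*} (s : Finset ι) {X : ι → Ω → ℝ} (hX : ∀ i ∈ s, Centered P (X i)) :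
    Centered P fun ω => ∑ i ∈ s, X i ω :=
  ⟨integrable_finsetSum _ fun i hi => (hX i hi).1, by
    rw [integral_finsetSum _ fun i hi => (hX i hi).1]
    exact Finset.sum_eq_zero fun i hi => (hX i hi).2⟩

theorem mul_of_indepFun (hX : Integrable X P) (hY : Centered P Y) (h : IndepFun X Y P) :
    Centered P fun ω => X ω * Y ω :=
  ⟨h.integrable_mul hX hY.1, by
    rw [h.integral_fun_mul_eq_mul_integral hX.1 hY.1.1, hY.2, mul_zero]⟩

end Centered

end Moments

/-- First and second moments of the increment `u = n - Φ e`, where `(Φ, n)` is independent of `e`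
and `n` is centred. -/
theorem increment_moments {ι Ω : Type*} [Fintype ι] {m₁ m₂ mΩ : MeasurableSpace Ω}
    {P : Measure Ω} [IsProbabilityMeasure P]
    (hind : Indep m₁ m₂ P) {e n : ι → Ω → ℝ} {Φ : ι → ι → Ω → ℝ} {C : ℝ}
    (he : ∀ i, Measurable[m₁] (e i)) (hn : ∀ i, Measurable[m₂] (n i))
    (hΦ : ∀ i j, Measurable[m₂] (Φ i j)) (he2 : ∀ i, MemLp (e i) 2 P)
    (hn2 : ∀ i, MemLp (n i) 2 P) (hΦ2 : ∀ i j, MemLp (Φ i j) 2 P)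
    (hn0 : ∀ i, ∫ ω, n i ω ∂P = 0) (hnC : ∀ i, ∫ ω, n i ω ^ 2 ∂P ≤ C)
    (hΦC : ∀ i j, ∫ ω, Φ i j ω ^ 2 ∂P ≤ C) {u : ι → Ω → ℝ}
    (hu : ∀ i ω, u i ω = n i ω - ∑ j, Φ i j ω * e j ω) :
    (∀ i, MemLp (u i) 2 P) ∧
    (∀ i, ∫ ω, u i ω ^ 2 ∂P ≤
      2 * (C + Fintype.card ι * (C * ∑ j, ∫ ω, e j ω * e j ω ∂P))) ∧
    (∀ i, ∫ ω, e i ω * u i ω ∂P = -∑ j, (∫ ω, Φ i j ω ∂P) * ∫ ω, e i ω * e j ω ∂P) := by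
  have hΦe : ∀ i j, IndepFun (Φ i j) (e j) P := fun i j =>
    (indepFun_of_indep hind (he j) (hΦ i j)).symm
  have hprod : ∀ i j, MemLp (fun ω => Φ i j ω * e j ω) 2 P := fun i j =>
    (integral_sq_mul_of_indepFun (hΦ2 i j) (he2 j) (hΦe i j)).1
  have hsum : ∀ i, MemLp (fun ω => ∑ j, Φ i j ω * e j ω) 2 P := fun i =>
    memLp_finsetSum _ fun j _ => hprod i j
  have hue : ∀ i, u i = fun ω => n i ω - ∑ j, Φ i j ω * e j ω := fun i => funext (hu i)
  refine ⟨fun i => ?_, fun i => ?_, fun i => ?_⟩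
  · rw [hue]; exact (hn2 i).sub (hsum i)
  · calc ∫ ω, u i ω ^ 2 ∂P
        ≤ ∫ ω, 2 * (n i ω ^ 2 + Fintype.card ι * ∑ j, (Φ i j ω * e j ω) ^ 2) ∂P := by
          refine integral_mono ?_ ?_ fun ω => ?_
          · rw [hue]; exact ((hn2 i).sub (hsum i)).integrable_sq
          · exact ((hn2 i).integrable_sq.add ((integrable_finsetSum _ fun j _ =>
              (hprod i j).integrable_sq).const_mul _)).const_mul 2
          -- Cauchy–Schwarz over the row gives the factor `card ι`; (a + b)² ≤ 2(a² + b²) gives the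
          -- 2. No independence between Φ and n is used.
          · have h1 := sq_sum_le_card_mul_sum_sq (s := Finset.univ)
              (f := fun j => Φ i j ω * e j ω)
            have h2 := add_sq_le (a := n i ω) (b := -∑ j, Φ i j ω * e j ω)
            rw [neg_sq, ← sub_eq_add_neg] at h2
            rw [Finset.card_univ] at h1
            simp only [hu]
            linarith
      _ = 2 * ((∫ ω, n i ω ^ 2 ∂P) + Fintype.card ι *
            ∑ j, (∫ ω, Φ i j ω ^ 2 ∂P) * ∫ ω, e j ω * e j ω ∂P) := by
          rw [integral_const_mul, integral_add (hn2 i).integrable_sq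
            ((integrable_finsetSum _ fun j _ => (hprod i j).integrable_sq).const_mul _),
            integral_const_mul, integral_finsetSum (hf := fun j _ => (hprod i j).integrable_sq)]
          congr 3
          refine Finset.sum_congr rfl fun j _ => ?_
          rw [(integral_sq_mul_of_indepFun (hΦ2 i j) (he2 j) (hΦe i j)).2]
          simp only [sq]
      _ ≤ _ := by
          rw [Finset.mul_sum (a := C)]
          gcongr with j _
          · exact hnC i
          · exact integral_nonneg fun ω => mul_self_nonneg _
          · exact hΦC i j
  -- The whole product e_i e_j is `m₁`-measurable, so Φ_ij factors out of the expectation; the e_i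
  -- n_i term vanishes because n is centred.
  · have hee : ∀ j, Measurable[m₁] fun ω => e i ω * e j ω := fun j => (he i).mul (he j)
    have hI : ∀ j, IndepFun (Φ i j) (fun ω => e i ω * e j ω) P := fun j =>
      (indepFun_of_indep hind (hee j) (hΦ i j)).symm
    have hen : Integrable (fun ω => e i ω * n i ω) P := (he2 i).integrable_mul (hn2 i)
    have hint : ∀ j, Integrable (fun ω => Φ i j ω * (e i ω * e j ω)) P := fun j =>
      (hI j).integrable_mul ((hΦ2 i j).integrable one_le_two) ((he2 i).integrable_mul (he2 j))
    have hexp : ∀ ω, e i ω * u i ω = e i ω * n i ω - ∑ j, Φ i j ω * (e i ω * e j ω) := by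
      intro ω
      rw [hu, mul_sub, Finset.mul_sum]
      congr 1
      exact Finset.sum_congr rfl fun j _ => by ring
    simp only [hexp]
    rw [integral_sub hen (integrable_finsetSum _ fun j _ => hint j),
      (indepFun_of_indep hind (he i) (hn i)).integral_fun_mul_eq_mul_integral (he2 i).1 (hn2 i).1,
      integral_finsetSum (hf := fun j _ => hint j), hn0, mul_zero, zero_sub]
    congr 1
    exact Finset.sum_congr rfl fun j _ =>
      (hI j).integral_fun_mul_eq_mul_integral (hΦ2 i j).1 ((he2 i).1.mul (he2 j).1)

/-! ### Recursion for the estimation error -/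

namespace RelaySystem

section Algebra

variable {M R : ℕ} {Ω : Type*} [MeasurableSpace Ω]

/-- The estimation error of SN `i`. -/
noncomputable def err (S : RelaySystem M R Ω) (t : ℕ) (i : Fin M) (ω : Ω) : ℝ :=
  S.x t ω i - S.θ

open Classical in
/-- The centred perturbation `Δ w + v + θ γ` that drives the estimation error. -/
noncomputable def noise (S : RelaySystem M R Ω) (t : ℕ) (i : Fin M) (ω : Ω) : ℝ :=
  ((if i ∈ S.measuring t then S.w t i ω else 0) + S.vTot t ω i) + S.θ * S.γ t ω i

/-- The increment of the estimation error per unit step size. -/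
noncomputable def incr (S : RelaySystem M R Ω) (t : ℕ) (i : Fin M) (ω : Ω) : ℝ :=
  S.noise t i ω - ∑ j, S.Φ t ω i j * S.err t j ω

theorem sum_L (S : RelaySystem M R Ω) (t : ℕ) (ω : Ω) (i : Fin M) : ∑ j, S.L t ω i j = 0 := by
  rw [← Finset.add_sum_erase _ _ (Finset.mem_univ i)]
  have : ∀ j ∈ Finset.univ.erase i, S.L t ω i j = S.lOff t ω i j := fun j hj => by
    simp [L, Finset.ne_of_mem_erase hj]
  rw [Finset.sum_congr rfl this]
  simp [L]

/-- Zero row sums of L give Φ(θ1) = θ(Δ - Γ)1: the Δ part cancels the signal θ in the measurements,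
and the Γ part leaves the forcing term θγ. -/
theorem err_succ (S : RelaySystem M R Ω) (t : ℕ) (i : Fin M) (ω : Ω) :
    S.err (t + 1) i ω = S.err t i ω + S.a t * S.incr t i ω := by
  have h1 : ∑ j, S.Φ t ω i j * S.x t ω j
      = (∑ j, S.Φ t ω i j * S.err t j ω) + S.θ * ∑ j, S.Φ t ω i j := by
    rw [Finset.mul_sum, ← Finset.sum_add_distrib]
    exact Finset.sum_congr rfl fun j _ => by simp only [err]; ring
  have h2 : ∑ j, S.Φ t ω i j = (∑ j, S.Δ t i j) - ∑ j, S.Γ t ω i j := by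
    simp only [Φ, Matrix.sub_apply, Matrix.add_apply, Finset.sum_add_distrib,
      Finset.sum_sub_distrib, sum_L, add_zero]
  have h3 : S.x (t + 1) ω i = S.x t ω i - S.a t * ∑ j, S.Φ t ω i j * S.x t ω j
      + S.a t * (S.Δ t).mulVec (S.y t ω) i + S.a t * S.vTot t ω i := by
    simp only [x, Matrix.sub_mulVec, Matrix.one_mulVec, Matrix.smul_mulVec, Pi.add_apply,
      Pi.sub_apply, Pi.smul_apply, smul_eq_mul]
    rfl
  rw [err, h3, h1, h2]
  simp only [incr, noise, err, Δ, Γ, Matrix.mulVec_diagonal, Matrix.diagonal_apply, y,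
    Finset.sum_ite_eq, Finset.mem_univ, if_true]
  split_ifs <;> ring

/-- Expanded so that each relayed summand is a deterministic coefficient times a product of two
independent factors, to which the moment lemmas apply term by term. -/
theorem γ_eq (S : RelaySystem M R Ω) (t : ℕ) (ω : Ω) (i : Fin M) :
    S.γ t ω i = ∑ j ∈ S.nbrS t (Sum.inl i), S.α t (Sum.inl j) * S.h t (Sum.inl i) (Sum.inl j) ω +
      ∑ p ∈ S.nbrR t (Sum.inl i), ∑ k ∈ S.nbrS t (Sum.inr p),
        S.α t (Sum.inr p) * (S.α t (Sum.inl k) *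
          (S.h t (Sum.inl i) (Sum.inr p) ω * S.h t (Sum.inr p) (Sum.inl k) ω)) + -S.b t i := by
  rw [γ, sub_eq_add_neg]
  congr 2
  refine Finset.sum_congr rfl fun p _ => ?_
  rw [Finset.mul_sum]
  exact Finset.sum_congr rfl fun k _ => by ring

theorem vTot_eq (S : RelaySystem M R Ω) (t : ℕ) (ω : Ω) (i : Fin M) :
    S.vTot t ω i = (∑ j ∈ S.nbrS t (Sum.inl i), S.v t (Sum.inl i) (Sum.inl j) ω +
        ∑ p ∈ S.nbrR t (Sum.inl i), S.v t (Sum.inl i) (Sum.inr p) ω) +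
      ∑ p ∈ S.nbrR t (Sum.inl i), ∑ k ∈ S.nbrS t (Sum.inr p),
        S.α t (Sum.inr p) * (S.h t (Sum.inl i) (Sum.inr p) ω * S.v t (Sum.inr p) (Sum.inl k) ω) := by
  rw [vTot]
  congr 1
  refine Finset.sum_congr rfl fun p _ => ?_
  rw [Finset.mul_sum]
  exact Finset.sum_congr rfl fun k _ => by ring

end Algebra

/-! ### Measurability and separation of past from present -/

section Measurability

variable {M R : ℕ} {Ω : Type*} {m mΩ : MeasurableSpace Ω} (S : RelaySystem M R Ω)
  {t : ℕ}

theorem measurable_lOff (hh : ∀ i j, Measurable[m] (S.h t i j)) (i j : Fin M) :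
    Measurable[m] fun ω => S.lOff t ω i j := by
  unfold lOff
  refine Measurable.const_mul (Measurable.add ?_ ?_) _
  · split_ifs
    · exact hh _ _
    · exact measurable_const
  · exact Finset.measurable_fun_sum _ fun k _ => ((hh _ _).const_mul _).mul (hh _ _)

theorem measurable_γ (hh : ∀ i j, Measurable[m] (S.h t i j)) (i : Fin M) :
    Measurable[m] fun ω => S.γ t ω i := by
  simp only [γ_eq]
  fun_prop

theorem measurable_Φ (hh : ∀ i j, Measurable[m] (S.h t i j)) (i j : Fin M) :
    Measurable[m] fun ω => S.Φ t ω i j := by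
  simp only [Φ, Matrix.sub_apply, Matrix.add_apply, L, Γ, Matrix.diagonal_apply, Matrix.of_apply]
  refine ((measurable_const).add ?_).sub ?_
  · split_ifs
    · exact (Finset.measurable_fun_sum _ fun k _ => S.measurable_lOff hh i k).neg
    · exact S.measurable_lOff hh i j
  · split_ifs
    · exact S.measurable_γ hh i
    · exact measurable_const

theorem measurable_noise (hh : ∀ i j, Measurable[m] (S.h t i j)) (hv : ∀ i j, Measurable[m] (S.v t i j))
    (hw : ∀ i, Measurable[m] (S.w t i)) (i : Fin M) : Measurable[m] (S.noise t i) := by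
  unfold noise
  simp only [vTot_eq]
  have := S.measurable_γ hh i
  refine (Measurable.add ?_ (by fun_prop)).add (by fun_prop)
  split_ifs
  · exact hw i
  · exact measurable_const

end Measurability

end RelaySystem

namespace RelaySystem.Source

variable {M R : ℕ}

/-- The sources that determine the estimates at time `t`. -/
def IsBefore (t : ℕ) : Source M R → Prop
  | .init => True
  | .meas s => s < t
  | .recv s => s < t
  | .fading s _ => s < t

/-- The sources active at time `t`. -/
def IsAt (t : ℕ) : Source M R → Prop
  | .init => False
  | .meas s => s = t
  | .recv s => s = t
  | .fading s _ => s = t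

theorem IsBefore.succ {t : ℕ} {q : Source M R} (h : q.IsBefore t) : q.IsBefore (t + 1) := by
  cases q <;> simp only [IsBefore] at * <;> omega

theorem IsAt.isBefore {t : ℕ} {q : Source M R} (h : q.IsAt t) : q.IsBefore (t + 1) := by
  cases q <;> simp only [IsBefore, IsAt] at * <;> omega

theorem disjoint_isBefore_isAt (t : ℕ) :
    Disjoint {q : Source M R | q.IsBefore t} {q | q.IsAt t} := by
  rw [Set.disjoint_left]
  intro q h1 h2
  cases q <;> simp only [IsBefore, IsAt, Set.mem_ofPred_eq] at * <;> omega

end RelaySystem.Source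

namespace RelaySystem

variable {M R : ℕ} {Ω : Type*} [mΩ : MeasurableSpace Ω] (S : RelaySystem M R Ω)

/-- The information available before time `t`. -/
@[reducible]
def past (t : ℕ) : MeasurableSpace Ω := ⨆ q ∈ {q : Source M R | q.IsBefore t}, S.sigmaOf q

/-- The randomness entering at time `t`. -/
@[reducible]
def present (t : ℕ) : MeasurableSpace Ω := ⨆ q ∈ {q : Source M R | q.IsAt t}, S.sigmaOf q

theorem sigmaOf_le (q : Source M R) : S.sigmaOf q ≤ mΩ := by
  cases q
  · exact S.measurable_x₀.comap_le
  · exact (measurable_pi_lambda _ fun i => S.measurable_w _ i).comap_le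
  · exact (measurable_pi_lambda _ fun q : Node M R × Node M R => S.measurable_v _ q.1 q.2).comap_le
  · exact (measurable_pi_lambda _ fun i => S.measurable_h _ i _).comap_le

theorem past_le_succ (t : ℕ) : S.past t ≤ S.past (t + 1) :=
  biSup_mono fun _ h => Source.IsBefore.succ h

theorem present_le_past_succ (t : ℕ) : S.present t ≤ S.past (t + 1) :=
  biSup_mono fun _ h => Source.IsAt.isBefore h

theorem measurable_sigmaOf_w (t : ℕ) (i : Fin M) : Measurable[S.sigmaOf (.meas t)] (S.w t i) :=
  (measurable_pi_apply i).comp (comap_measurable fun ω (i : Fin M) => S.w t i ω)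

theorem measurable_sigmaOf_v (t : ℕ) (i j : Node M R) :
    Measurable[S.sigmaOf (.recv t)] (S.v t i j) :=
  (measurable_pi_apply (i, j)).comp
    (comap_measurable fun ω (q : Node M R × Node M R) => S.v t q.1 q.2 ω)

theorem measurable_sigmaOf_h (t : ℕ) (i j : Node M R) :
    Measurable[S.sigmaOf (.fading t j)] (S.h t i j) :=
  (measurable_pi_apply i).comp (comap_measurable fun ω (i : Node M R) => S.h t i j ω)

theorem sigmaOf_le_present {t : ℕ} {q : Source M R} (h : q.IsAt t) : S.sigmaOf q ≤ S.present t :=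
  le_biSup S.sigmaOf h

theorem measurable_present_h (t : ℕ) (i j : Node M R) : Measurable[S.present t] (S.h t i j) :=
  (S.measurable_sigmaOf_h t i j).mono (S.sigmaOf_le_present (by simp [Source.IsAt])) le_rfl

theorem measurable_present_Φ (t : ℕ) (i j : Fin M) :
    Measurable[S.present t] fun ω => S.Φ t ω i j :=
  S.measurable_Φ (S.measurable_present_h t) i j

theorem measurable_present_noise (t : ℕ) (i : Fin M) : Measurable[S.present t] (S.noise t i) :=
  S.measurable_noise (S.measurable_present_h t)
    (fun i j => (S.measurable_sigmaOf_v t i j).mono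
      (S.sigmaOf_le_present (by simp [Source.IsAt])) le_rfl)
    (fun i => (S.measurable_sigmaOf_w t i).mono
      (S.sigmaOf_le_present (by simp [Source.IsAt])) le_rfl) i

/-- The recursion is nonanticipating: each step adds only the sources of the current time. -/
theorem measurable_past_err (t : ℕ) (i : Fin M) : Measurable[S.past t] (S.err t i) := by
  induction t generalizing i with
  | zero =>
    have h1 : Measurable[S.sigmaOf .init] fun ω => S.x₀ ω i - S.θ :=
      ((measurable_pi_apply i).comp (comap_measurable S.x₀)).sub_const _
    have h2 : S.sigmaOf .init ≤ S.past 0 :=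
      le_biSup S.sigmaOf (show Source.init ∈ {q : Source M R | q.IsBefore 0} from trivial)
    exact h1.mono h2 le_rfl
  | succ t ih =>
    have he : ∀ j, Measurable[S.past (t + 1)] (S.err t j) := fun j =>
      (ih j).mono (S.past_le_succ t) le_rfl
    have hn := (S.measurable_present_noise t i).mono (S.present_le_past_succ t) le_rfl
    have hΦ := fun j => (S.measurable_present_Φ t i j).mono (S.present_le_past_succ t) le_rfl
    have h1 : S.err (t + 1) i = fun ω => S.err t i ω + S.a t *
        (S.noise t i ω - ∑ j, S.Φ t ω i j * S.err t j ω) := funext fun ω => S.err_succ t i ω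
    rw [h1]
    exact (he i).add ((hn.sub (Finset.measurable_fun_sum _ fun j _ => (hΦ j).mul (he j))).const_mul _)

/-- Disjoint sets of labels in a mutually independent family generate independent σ-algebras. -/
theorem indep_past_present {P : Measure Ω} (h : S.Assumption4 P) (t : ℕ) :
    Indep (S.past t) (S.present t) P :=
  indep_iSup_of_disjoint S.sigmaOf_le h (Source.disjoint_isBefore_isAt t)

/-! ### Uniform moment bounds for the network -/

section Moments

variable {S} {P : Measure Ω}

theorem l2Bdd_h (h3 : S.Assumption3 P) (i j : Node M R) : L2Bdd P fun t => S.h t i j :=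
  ⟨fun t => h3.memLp_h t i j, h3.bound_h.imp fun _ hC t => hC t i j⟩

theorem l2Bdd_v (h3 : S.Assumption3 P) (i j : Node M R) : L2Bdd P fun t => S.v t i j :=
  ⟨fun t => h3.memLp_v t i j, h3.bound_v.imp fun _ hC t => hC t i j⟩

theorem l2Bdd_w {T : ℕ} (h2 : S.Assumption2 P T) (i : Fin M) : L2Bdd P fun t => S.w t i := by
  refine ⟨fun t => h2.memLp t i, ∫ ω, S.w 0 i ω ^ 2 ∂P, fun t => le_of_eq ?_⟩
  have h : Measurable fun z : Fin M → ℝ => z i ^ 2 := (measurable_pi_apply i).pow_const 2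
  exact ((h2.identDistrib t).comp h).integral_eq

/-- The two hops have different transmitters, the relay `p` and the sensor `k`, so their fading
coefficients are independent even at the same time. -/
theorem l2Bdd_relay (h3 : S.Assumption3 P) (i k : Fin M) (p : Fin R) :
    L2Bdd P fun t ω => S.h t (Sum.inl i) (Sum.inr p) ω * S.h t (Sum.inr p) (Sum.inl k) ω := by
  refine (l2Bdd_h h3 _ _).mul_of_indepFun (l2Bdd_h h3 _ _) fun t => ?_
  have h : ((t, Sum.inr p) : ℕ × Node M R) ≠ (t, Sum.inl k) := by simp
  exact (h3.indep_h.indepFun h).comp (φ := fun z : Node M R → ℝ => z (Sum.inl i))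
    (ψ := fun z : Node M R → ℝ => z (Sum.inr p)) (measurable_pi_apply _) (measurable_pi_apply _)

theorem indepFun_h_v (h4 : S.Assumption4 P) (t : ℕ) (i j k l : Node M R) :
    IndepFun (S.h t i j) (S.v t k l) P := by
  have h : (Source.fading t j : Source M R) ≠ Source.recv t := by simp
  exact indepFun_of_indep (iIndep.indep h4 h) (S.measurable_sigmaOf_h t i j)
    (S.measurable_sigmaOf_v t k l)

variable {C : ℝ} (hα : ∀ t i, S.α t i ≤ C)
include hα

theorem abs_α_le (t : ℕ) (i : Node M R) : |S.α t i| ≤ C := by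
  rw [abs_of_pos (S.α_pos t i)]; exact hα t i

theorem l2Bdd_lOff (h3 : S.Assumption3 P) (i j : Fin M) : L2Bdd P fun t ω => S.lOff t ω i j := by
  refine L2Bdd.const_mul (C := C) (L2Bdd.add ((l2Bdd_h h3 _ _).ite _)
    (L2Bdd.sum_varying _ fun k => ?_)) (fun t => by rw [abs_neg]; exact abs_α_le hα _ _)
  simp only [mul_assoc]
  exact (l2Bdd_relay h3 i j k).const_mul fun t => abs_α_le hα _ _

theorem l2Bdd_L (h3 : S.Assumption3 P) (i j : Fin M) : L2Bdd P fun t ω => S.L t ω i j := by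
  simp only [L, Matrix.of_apply]
  split_ifs
  · exact (L2Bdd.sum _ fun k _ => l2Bdd_lOff hα h3 i k).neg
  · exact l2Bdd_lOff hα h3 i j

theorem l2Bdd_vTot (h3 : S.Assumption3 P) (h4 : S.Assumption4 P) (i : Fin M) :
    L2Bdd P fun t ω => S.vTot t ω i := by
  simp only [vTot_eq]
  refine L2Bdd.add (L2Bdd.add (L2Bdd.sum_varying _ fun j => l2Bdd_v h3 _ _)
    (L2Bdd.sum_varying _ fun p => l2Bdd_v h3 _ _))
    (L2Bdd.sum_varying _ fun p => L2Bdd.sum_varying _ fun k => ?_)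
  exact ((l2Bdd_h h3 _ _).mul_of_indepFun (l2Bdd_v h3 _ _)
    fun t => indepFun_h_v h4 t _ _ _ _).const_mul fun t => abs_α_le hα _ _

variable [IsProbabilityMeasure P]

theorem l2Bdd_γ (h3 : S.Assumption3 P) {D : ℝ} (hb : ∀ t i, |S.b t i| ≤ D) (i : Fin M) :
    L2Bdd P fun t ω => S.γ t ω i := by
  simp only [γ_eq]
  refine L2Bdd.add (L2Bdd.add (L2Bdd.sum_varying _ fun j => ?_)
    (L2Bdd.sum_varying _ fun p => L2Bdd.sum_varying _ fun k => ?_))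
    (L2Bdd.const (C := D) fun t => by rw [abs_neg]; exact hb t i)
  · exact (l2Bdd_h h3 _ _).const_mul fun t => abs_α_le hα _ _
  · exact ((l2Bdd_relay h3 i k p).const_mul fun t => abs_α_le hα _ _).const_mul
      fun t => abs_α_le hα _ _

open Classical in
theorem l2Bdd_noise {T : ℕ} (h2 : S.Assumption2 P T) (h3 : S.Assumption3 P)
    (h4 : S.Assumption4 P) {D : ℝ} (hb : ∀ t i, |S.b t i| ≤ D) (i : Fin M) :
    L2Bdd P fun t => S.noise t i :=
  (((l2Bdd_w h2 i).ite _).add (l2Bdd_vTot hα h3 h4 i)).add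
    ((l2Bdd_γ hα h3 hb i).const_mul (c := fun _ => S.θ) fun _ => le_rfl)

theorem l2Bdd_Φ (h3 : S.Assumption3 P) {D : ℝ} (hb : ∀ t i, |S.b t i| ≤ D) (i j : Fin M) :
    L2Bdd P fun t ω => S.Φ t ω i j := by
  have hΔ : L2Bdd P fun t _ => S.Δ t i j := L2Bdd.const (C := 1) fun t => by
    simp only [Δ, Matrix.diagonal_apply]
    split_ifs <;> simp
  have hΓ : L2Bdd P fun t ω => -S.Γ t ω i j := by
    refine L2Bdd.neg ?_
    simp only [Γ, Matrix.diagonal_apply]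
    split_ifs
    · exact l2Bdd_γ hα h3 hb i
    · exact L2Bdd.zero
  simp only [Φ, Matrix.sub_apply, Matrix.add_apply, sub_eq_add_neg]
  exact (hΔ.add (l2Bdd_L hα h3 i j)).add hΓ

open Classical in
theorem centered_noise {T : ℕ} (h2 : S.Assumption2 P T) (h3 : S.Assumption3 P)
    (h4 : S.Assumption4 P) {D : ℝ} (hb : ∀ t i, |S.b t i| ≤ D)
    (hΓ : ∀ t, meanMatrix P (S.Γ t) = 0) (t : ℕ) (i : Fin M) : Centered P (S.noise t i) := by
  have hv : ∀ j k, Centered P (S.v t j k) := fun j k =>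
    ⟨(h3.memLp_v t j k).integrable one_le_two, h3.mean_v t j k⟩
  have hγ : Centered P fun ω => S.γ t ω i := by
    refine ⟨((l2Bdd_γ hα h3 hb i).1 t).integrable one_le_two, ?_⟩
    simpa [meanMatrix, Γ] using congrFun₂ (hΓ t) i i
  have hw : Centered P (S.w t i) := ⟨(h2.memLp t i).integrable one_le_two, h2.mean t i⟩
  unfold noise
  simp only [vTot_eq]
  refine (Centered.add ?_ (((Centered.sum _ fun j _ => hv _ _).add
    (Centered.sum _ fun p _ => hv _ _)).add
    (Centered.sum _ fun p _ => Centered.sum _ fun k _ => ?_))).add (hγ.const_mul _)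
  · split_ifs
    · exact hw
    · exact ⟨integrable_zero _ _ _, integral_zero _ _⟩
  · exact (Centered.mul_of_indepFun ((h3.memLp_h t _ _).integrable one_le_two) (hv _ _)
      (indepFun_h_v h4 t _ _ _ _)).const_mul _

theorem integral_Φ (h3 : S.Assumption3 P) {D : ℝ} (hb : ∀ t i, |S.b t i| ≤ D)
    (hΓ : ∀ t, meanMatrix P (S.Γ t) = 0) (t : ℕ) (i j : Fin M) :
    ∫ ω, S.Φ t ω i j ∂P = S.Δ t i j + S.Lbar P t i j := by
  have h0 : ∫ ω, S.Γ t ω i j ∂P = 0 := congrFun₂ (hΓ t) i j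
  have hL : Integrable (fun ω => S.L t ω i j) P :=
    ((l2Bdd_L hα h3 i j).1 t).integrable one_le_two
  have hΓi : Integrable (fun ω => S.Γ t ω i j) P := by
    simp only [Γ, Matrix.diagonal_apply]
    split_ifs
    · exact ((l2Bdd_γ hα h3 hb i).1 t).integrable one_le_two
    · exact integrable_zero _ _ _
  simp only [Φ, Matrix.sub_apply, Matrix.add_apply]
  have hΔL : Integrable (fun ω => S.Δ t i j + S.L t ω i j) P := (integrable_const _).add hL
  rw [integral_sub hΔL hΓi, integral_add (integrable_const _) hL, h0]
  simp [Lbar, meanMatrix]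

end Moments

end RelaySystem

/-! ### Second moments of the error -/

namespace RelaySystem

variable {M R : ℕ} {Ω : Type*} [MeasurableSpace Ω]

theorem isHermitian_J (S : RelaySystem M R Ω) (P : Measure Ω) (τ k : ℕ) :
    (S.J P τ k).IsHermitian := by
  ext i j
  simp only [Matrix.conjTranspose_apply, star_trivial, J, Matrix.sum_apply, Matrix.smul_apply,
    Matrix.add_apply, Matrix.transpose_apply, smul_eq_mul]
  refine Finset.sum_congr rfl fun s _ => ?_
  have : S.Δ s j i = S.Δ s i j := by
    simp only [Δ, Matrix.diagonal_apply]
    by_cases h : i = j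
    · rw [h]
    · simp [h, Ne.symm h]
  rw [this]
  ring

/-- The second moments of the estimation errors. -/
noncomputable def secondMoment (S : RelaySystem M R Ω) (P : Measure Ω) (t : ℕ) (i j : Fin M) : ℝ :=
  ∫ ω, S.err t i ω * S.err t j ω ∂P

theorem secondMoment_comm (S : RelaySystem M R Ω) (P : Measure Ω) (t : ℕ) (i j : Fin M) :
    S.secondMoment P t i j = S.secondMoment P t j i := by
  simp only [secondMoment, mul_comm]

theorem secondMoment_self_nonneg (S : RelaySystem M R Ω) (P : Measure Ω) (t : ℕ) (i : Fin M) :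
    0 ≤ S.secondMoment P t i i := integral_nonneg fun _ => mul_self_nonneg _

theorem secondMoment_succ {S : RelaySystem M R Ω} {P : Measure Ω} {t : ℕ}
    (he : ∀ i, MemLp (S.err t i) 2 P) (hu : ∀ i, MemLp (S.incr t i) 2 P) (i j : Fin M) :
    S.secondMoment P (t + 1) i j = S.secondMoment P t i j
      + S.a t * ((∫ ω, S.err t i ω * S.incr t j ω ∂P) + ∫ ω, S.err t j ω * S.incr t i ω ∂P)
      + S.a t ^ 2 * ∫ ω, S.incr t i ω * S.incr t j ω ∂P := by
  have h : ∀ ω, S.err (t + 1) i ω * S.err (t + 1) j ω = S.err t i ω * S.err t j ω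
      + S.a t * (S.err t i ω * S.incr t j ω + S.err t j ω * S.incr t i ω)
      + S.a t ^ 2 * (S.incr t i ω * S.incr t j ω) := fun ω => by
    rw [err_succ, err_succ]; ring
  have h1 : Integrable (fun ω => S.err t i ω * S.err t j ω) P := (he i).integrable_mul (he j)
  have h2 : Integrable (fun ω => S.err t i ω * S.incr t j ω) P := (he i).integrable_mul (hu j)
  have h3 : Integrable (fun ω => S.err t j ω * S.incr t i ω) P := (he j).integrable_mul (hu i)
  have h4 : Integrable (fun ω => S.incr t i ω * S.incr t j ω) P := (hu i).integrable_mul (hu j)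
  have h23 : Integrable
      (fun ω => S.a t * (S.err t i ω * S.incr t j ω + S.err t j ω * S.incr t i ω)) P :=
    (h2.add h3).const_mul _
  have h123 : Integrable (fun ω => S.err t i ω * S.err t j ω
      + S.a t * (S.err t i ω * S.incr t j ω + S.err t j ω * S.incr t i ω)) P := h1.add h23
  simp only [secondMoment, h]
  rw [integral_add h123 (h4.const_mul _), integral_add h1 h23, integral_const_mul,
    integral_const_mul, integral_add h2 h3]

theorem memLp_err_succ {S : RelaySystem M R Ω} {P : Measure Ω} {t : ℕ}
    (he : ∀ i, MemLp (S.err t i) 2 P) (hu : ∀ i, MemLp (S.incr t i) 2 P) (i : Fin M) :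
    MemLp (S.err (t + 1) i) 2 P := by
  rw [show S.err (t + 1) i = fun ω => S.err t i ω + S.a t * S.incr t i ω from
    funext fun ω => S.err_succ t i ω]
  exact (he i).add ((hu i).const_mul _)

/-- The Rayleigh bound holds pointwise at the random vector e(t) and is then integrated. The time
`t` stays fixed while `s` runs over the block, which is the frozen form needed for the Lyapunov
argument. -/
theorem minEigenvalue_J_mul_le {S : RelaySystem M R Ω} {P : Measure Ω} (τ k : ℕ) {t : ℕ}
    (he : ∀ i, MemLp (S.err t i) 2 P) :
    minEigenvalue (S.J P τ k) * ∑ i, S.secondMoment P t i i ≤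
      ∑ s ∈ Finset.Ico (k * τ) ((k + 1) * τ), S.a s * ∑ i, ∑ j,
        (2 * S.Δ s i j + S.Lbar P s i j + S.Lbar P s j i) * S.secondMoment P t i j := by
  have hint : ∀ i j, Integrable (fun ω => S.err t i ω * S.err t j ω) P := fun i j =>
    (he i).integrable_mul (he j)
  have hquad : ∀ W : Fin M → Fin M → ℝ,
      ∫ ω, ∑ i, ∑ j, W i j * (S.err t i ω * S.err t j ω) ∂P
        = ∑ i, ∑ j, W i j * S.secondMoment P t i j := by
    intro W
    rw [integral_finsetSum _ fun i _ => integrable_finsetSum _ fun j _ => (hint i j).const_mul _]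
    refine Finset.sum_congr rfl fun i _ => ?_
    rw [integral_finsetSum _ fun j _ => (hint i j).const_mul _]
    exact Finset.sum_congr rfl fun j _ => integral_const_mul _ _
  have h1 : minEigenvalue (S.J P τ k) * ∑ i, S.secondMoment P t i i ≤
      ∑ i, ∑ j, S.J P τ k i j * S.secondMoment P t i j := by
    calc _ = ∫ ω, minEigenvalue (S.J P τ k) * ∑ i, S.err t i ω ^ 2 ∂P := by
          rw [integral_const_mul, integral_finsetSum _ fun i _ => (he i).integrable_sq]
          simp only [secondMoment, sq]
      _ ≤ ∫ ω, ∑ i, ∑ j, S.J P τ k i j * (S.err t i ω * S.err t j ω) ∂P :=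
          integral_mono ((integrable_finsetSum _ fun i _ => (he i).integrable_sq).const_mul _)
            (integrable_finsetSum _ fun i _ => integrable_finsetSum _ fun j _ =>
              (hint i j).const_mul _)
            fun ω => minEigenvalue_mul_dotProduct_le (S.isHermitian_J P τ k) fun i => S.err t i ω
      _ = _ := hquad _
  refine h1.trans (le_of_eq ?_)
  simp only [J, Matrix.sum_apply, Matrix.smul_apply, Matrix.add_apply, Matrix.transpose_apply,
    smul_eq_mul, Finset.sum_mul, Finset.mul_sum]
  symm
  refine Finset.sum_comm.trans (Finset.sum_congr rfl fun i _ => Finset.sum_comm.trans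
    (Finset.sum_congr rfl fun j _ => Finset.sum_congr rfl fun s _ => ?_))
  ring

end RelaySystem

/-! ### Mean-square convergence -/

theorem theorem2 {M R : ℕ} {Ω : Type*} [MeasurableSpace Ω] (P : Measure Ω)
    [IsProbabilityMeasure P] (S : RelaySystem M R Ω) (B T : ℕ)
    (hx₀ : ∀ i, MemLp (fun ω => S.x₀ ω i) 2 P)
    (hα : ∃ C : ℝ, ∀ t i, S.α t i ≤ C)
    (hb : ∃ C : ℝ, ∀ t i, |S.b t i| ≤ C)
    (hΓ : ∀ t, meanMatrix P (S.Γ t) = 0)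
    (ha_decay : SlowDecay S.a)
    (ha_sums : PersistentSums S.a)
    (ha_sq : Summable fun t => S.a t ^ 2)
    (hJ : ∃ c : ℝ, 0 < c ∧ ∀ k : ℕ,
      c * S.a (k * max T B) ≤ minEigenvalue (S.J P (max T B) k))
    (hA1 : S.Assumption1 P B) (hA2 : S.Assumption2 P T)
    (hA3 : S.Assumption3 P) (hA4 : S.Assumption4 P) :
    (∀ t, Integrable (fun ω => ‖WithLp.toLp 2 (fun i => S.x t ω i - S.θ)‖ ^ 2) P) ∧
      Tendsto (fun t => ∫ ω, ‖WithLp.toLp 2 (fun i => S.x t ω i - S.θ)‖ ^ 2 ∂P)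
        atTop (𝓝 0) := by
  obtain ⟨Cα, hα⟩ := hα
  obtain ⟨Cb, hb⟩ := hb
  obtain ⟨c, hc, hJ⟩ := hJ
  obtain ⟨⟨_, _, _, hdec⟩, ha0⟩ := ha_decay
  have hnoise := RelaySystem.l2Bdd_noise hα hA2 hA3 hA4 hb
  have hΦ := RelaySystem.l2Bdd_Φ hα hA3 hb
  have hL := RelaySystem.l2Bdd_L hα hA3
  obtain ⟨Cn, hCn0, hCn⟩ := L2Bdd.exists_bound hnoise
  obtain ⟨CΦ, hCΦ0, hCΦ⟩ := L2Bdd.exists_bound fun q : Fin M × Fin M => hΦ q.1 q.2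
  obtain ⟨CL, hCL0, hCL⟩ := L2Bdd.exists_bound fun q : Fin M × Fin M => hL q.1 q.2
  set C := max Cn CΦ with hC
  have hC0 : 0 ≤ C := hCn0.trans (le_max_left _ _)
  -- Conditional on e(t) being in L², so that it can drive the induction that proves this.
  have hincr := fun t (he : ∀ i, MemLp (S.err t i) 2 P) =>
    increment_moments (C := C) (S.indep_past_present hA4 t) (S.measurable_past_err t)
      (S.measurable_present_noise t) (S.measurable_present_Φ t) he
      (fun i => (hnoise i).1 t) (fun i j => (hΦ i j).1 t)
      (fun i => (RelaySystem.centered_noise hα hA2 hA3 hA4 hb hΓ t i).2)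
      (fun i => (hCn i t).trans (le_max_left _ _)) (fun i j => (hCΦ (i, j) t).trans (le_max_right _ _))
      (u := S.incr t) (fun i ω => rfl)
  have he : ∀ t i, MemLp (S.err t i) 2 P := by
    intro t
    induction t with
    | zero => exact fun i => (hx₀ i).sub (memLp_const _)
    | succ t ih => exact RelaySystem.memLp_err_succ ih (hincr t ih).1
  have hu := fun t => (hincr t (he t)).1
  set V : ℕ → ℝ := fun t => ∑ i, S.secondMoment P t i i with hVdef
  have hVi : ∀ t i, S.secondMoment P t i i ≤ V t := fun t i =>
    Finset.single_le_sum (f := fun i => S.secondMoment P t i i)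
      (fun i _ => S.secondMoment_self_nonneg P t i) (Finset.mem_univ i)
  have hV0 : ∀ t, 0 ≤ V t := fun t =>
    Finset.sum_nonneg fun i _ => S.secondMoment_self_nonneg P t i
  set D : ℝ := 2 * (C + M * C) with hD
  have hD0 : 0 ≤ D := by positivity
  have hu2 : ∀ t i, ∫ ω, S.incr t i ω ^ 2 ∂P ≤ D * (1 + V t) := by
    intro t i
    refine ((hincr t (he t)).2.1 i).trans ?_
    rw [Fintype.card_fin]
    change 2 * (C + M * (C * V t)) ≤ _
    have h1 : 0 ≤ C * V t := mul_nonneg hC0 (hV0 t)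
    have h2 : 0 ≤ M * C := by positivity
    rw [hD]
    nlinarith
  have hee : ∀ t i, ∫ ω, S.err t i ω ^ 2 ∂P ≤ V t := fun t i => by
    refine le_trans (le_of_eq ?_) (hVi t i)
    simp only [RelaySystem.secondMoment, sq]
  obtain ⟨A, hA⟩ := ha0.bddAbove_range
  have hA : ∀ t, S.a t ≤ A := fun t => hA ⟨t, rfl⟩
  have hA0 : 0 ≤ A := (S.a_pos 0).le.trans (hA 0)
  obtain ⟨N, hN⟩ := eventually_atTop.1 hdec
  have hanti : ∀ t, N ≤ t → S.a (t + 1) ≤ S.a t := fun t ht =>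
    (div_le_one (S.a_pos t)).1 (hN t ht).2
  have hLbar : ∀ t i j, |S.Lbar P t i j| ≤ CL + 1 := by
    intro t i j
    have h1 := abs_integral_le_of_memLp ((hL i j).1 t)
    have h2 := hCL (i, j) t
    change |∫ ω, S.L t ω i j ∂P| ≤ _
    simp only at h2
    linarith
  have hV : Tendsto V atTop (𝓝 0) := by
    refine tendsto_zero_of_block_coercive (S := S.secondMoment P) (a := S.a)
      (Q := fun t i j => 2 * S.Δ t i j + S.Lbar P t i j + S.Lbar P t j i)
      -- One constant must serve three bounds: the summands control, in order, the drift of S, the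
      -- quadratic remainder, and the entries of Q.
      (K := (1 + D + A * D) + M * D + (2 + 2 * (CL + 1))) (τ := max T B) (N := N) (c := c)
      (lt_max_of_lt_left hA2.T_pos) hc S.a_pos hanti ha0 ha_sums.not_summable ha_sq
      (fun t => rfl) hV0 ?_ ?_ ?_ ?_
    · intro t i j
      have h1 : |S.Δ t i j| ≤ 1 := by
        simp only [RelaySystem.Δ, Matrix.diagonal_apply]
        split_ifs <;> simp
      have h2 := abs_le.1 h1
      have h3 := abs_le.1 (hLbar t i j)
      have h4 := abs_le.1 (hLbar t j i)
      have h5 : 0 ≤ (1 + D + A * D) + M * D := by positivity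
      exact abs_le.2 ⟨by linarith, by linarith⟩
    · intro t i j
      have hVt := hV0 t
      have hat := (S.a_pos t).le
      rw [RelaySystem.secondMoment_succ (he t) (hu t)]
      have h1 := abs_integral_mul_le (he t i) (hu t j)
      have h2 := abs_integral_mul_le (he t j) (hu t i)
      have h3 := abs_integral_mul_le (hu t i) (hu t j)
      have h4 : |(∫ ω, S.err t i ω * S.incr t j ω ∂P) + ∫ ω, S.err t j ω * S.incr t i ω ∂P|
          ≤ (1 + D) * (1 + V t) := by
        refine (abs_add_le _ _).trans ?_
        linarith [hee t i, hee t j, hu2 t i, hu2 t j]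
      have h5 : |∫ ω, S.incr t i ω * S.incr t j ω ∂P| ≤ D * (1 + V t) := by
        linarith [hu2 t i, hu2 t j]
      rw [add_assoc, add_sub_cancel_left]
      refine (abs_add_le _ _).trans ?_
      rw [abs_mul, abs_mul, abs_of_nonneg hat, abs_of_nonneg (sq_nonneg (S.a t))]
      calc _ ≤ S.a t * ((1 + D) * (1 + V t)) + S.a t ^ 2 * (D * (1 + V t)) := by gcongr
        _ ≤ S.a t * ((1 + D) * (1 + V t)) + A * S.a t * (D * (1 + V t)) := by
            rw [sq]; gcongr; exact hA t
        _ = (1 + D + A * D) * S.a t * (1 + V t) := by ring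
        _ ≤ _ := by
            refine mul_le_mul_of_nonneg_right (mul_le_mul_of_nonneg_right ?_ hat) (by linarith)
            have : 0 ≤ M * D + (2 + 2 * (CL + 1)) := by positivity
            linarith
    · intro t
      have hVt := hV0 t
      have h1 : V (t + 1) = V t + S.a t * (2 * ∑ i, ∫ ω, S.err t i ω * S.incr t i ω ∂P)
          + S.a t ^ 2 * ∑ i, ∫ ω, S.incr t i ω ^ 2 ∂P := by
        simp only [hVdef, RelaySystem.secondMoment_succ (he t) (hu t), Finset.sum_add_distrib,
          ← Finset.mul_sum, ← two_mul, sq]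
      have h2 : 2 * ∑ i, ∫ ω, S.err t i ω * S.incr t i ω ∂P = -∑ i, ∑ j,
          (2 * S.Δ t i j + S.Lbar P t i j + S.Lbar P t j i) * S.secondMoment P t i j := by
        -- Symmetry of S lets L̄ be replaced by its transpose, so the drift sees only the symmetric
        -- part of L̄, as J_k does.
        have h3 : ∑ i, ∑ j, S.Lbar P t j i * S.secondMoment P t i j
            = ∑ i, ∑ j, S.Lbar P t i j * S.secondMoment P t i j := by
          rw [Finset.sum_comm]
          exact Finset.sum_congr rfl fun i _ => Finset.sum_congr rfl fun j _ => by
            rw [S.secondMoment_comm]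
        simp only [(hincr t (he t)).2.2, RelaySystem.integral_Φ hα hA3 hb hΓ]
        simp only [add_mul, Finset.sum_add_distrib, h3, Finset.sum_neg_distrib, mul_assoc,
          ← Finset.mul_sum]
        simp only [RelaySystem.secondMoment]
        ring
      have h3 : ∑ i, ∫ ω, S.incr t i ω ^ 2 ∂P ≤ M * (D * (1 + V t)) := by
        refine (Finset.sum_le_sum fun i _ => hu2 t i).trans (le_of_eq ?_)
        simp
      rw [h1, h2]
      have h4 : S.a t ^ 2 * ∑ i, ∫ ω, S.incr t i ω ^ 2 ∂P ≤
          ((1 + D + A * D) + M * D + (2 + 2 * (CL + 1))) * S.a t ^ 2 * (1 + V t) := by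
        calc _ ≤ S.a t ^ 2 * (M * (D * (1 + V t))) := by gcongr
          _ = M * D * S.a t ^ 2 * (1 + V t) := by ring
          _ ≤ _ := by
            gcongr
            have : 0 ≤ (1 + D + A * D) + (2 + 2 * (CL + 1)) := by positivity
            linarith
      linarith
    · intro k
      exact (mul_le_mul_of_nonneg_right (hJ k) (hV0 _)).trans
        (RelaySystem.minEigenvalue_J_mul_le _ _ (he _))
  have hnorm : ∀ t ω, ‖WithLp.toLp 2 (fun i => S.x t ω i - S.θ)‖ ^ 2 = ∑ i, S.err t i ω ^ 2 := by
    intro t ω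
    rw [PiLp.norm_sq_eq_of_L2]
    simp [RelaySystem.err]
  simp only [hnorm]
  refine ⟨fun t => integrable_finsetSum _ fun i _ => (he t i).integrable_sq, ?_⟩
  convert hV using 2 with t
  rw [integral_finsetSum _ fun i _ => (he t i).integrable_sq]
  simp only [hVdef, RelaySystem.secondMoment, sq]
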